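/- **Setting.** A rooted loop of length $2k$ ($k\ge 1$) in $\mathbb Z^3$ is a tuple $\ell=(\ell_0,\dots,\ell_{2k})$ of points of $\mathbb Z^3$ with $|\ell_i-\ell_{i-1}|=1$ and $\ell_0=\ell_{2k}$. The loop measure $\mu$ gives mass $\frac1{2k}\left(\frac16\right)^{2k}$ to each loop of length $2k$. The random walk loop soup is a Poisson point process on (rooted loops)$\,\times(0,\infty)$ with intensity $\mu\otimes\mathrm{Leb}$. For $\lambda>0$, the random walk loop soup $\mathcal R^\lambda$ of intensity $\lambda$ is the multiset of loops $\ell$ of its points $(\ell,t)$ with $t\le\lambda$. A loop is identified with the set of its vertices when we speak of its (Euclidean) diameter and of inclusions. **Proposition 5.1.** There exists $\alpha>0$ such that for every bounded connected open set $U\subset\mathbb R^3$ with smooth ($C^\infty$) boundary there exists $C=C(\alpha,U)<\infty$ such that the following holds for all $\lambda>0$, all integers $n\ge1$, and all $0<\varepsilon<\delta$ such that every bounded connected component of $U^c$ has diameter $>\delta$. 1. Let $U_n=nU\cap\mathbb Z^3$ and let $U_n^{-r}$ be the set of points of $U_n$ at distance $>r$ from $\mathbb Z^3\setminus U_n$.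 Then $$\mathbb P\left[\text{there exists }\ell\in\mathcal R^\lambda\text{ with diameter}>\delta n\text{ such that }\ell\subset U_n\text{ and }\ell\nsubseteq U_n^{-\varepsilon n}\right]\le C\,\lambda\,\frac{\varepsilon^\alpha}{\delta^5}.$$ 2. If moreover $\varepsilon n\ge1$, the same bound holds with $U_n=nU$ and with $U_n^{-r}$ the set of points of $U_n$ at distance $>r$ from $\mathbb R^3\setminus U_n$. -/

import Mathlib

open MeasureTheory ProbabilityTheory
open scoped ENNReal Pointwise

noncomputable section

/-- A point of `ℤ^d`, viewed in Euclidean space `ℝ^d`. -/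
def latticePoint {d : ℕ} (x : Fin d → ℤ) : EuclideanSpace ℝ (Fin d) :=
  WithLp.toLp 2 (fun i => (x i : ℝ))

/-- The lattice `ℤ^d`, as a subset of Euclidean space `ℝ^d`. -/
def integerLattice (d : ℕ) : Set (EuclideanSpace ℝ (Fin d)) :=
  Set.range (latticePoint (d := d))

/-- A rooted loop in `ℤ^d` of length `2 n`, `n ≥ 1`: a `(2 n + 1)`-tuple of lattice points in which
successive points are at Euclidean distance `1` and whose first and last points agree. -/
structure RootedLoop (d : ℕ) where
  /-- half of the length of the loop -/
  halfLength : ℕ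
  halfLength_pos : 1 ≤ halfLength
  /-- the points of the loop, in order -/
  path : Fin (2 * halfLength + 1) → (Fin d → ℤ)
  step : ∀ i : Fin (2 * halfLength),
    dist (latticePoint (path i.castSucc)) (latticePoint (path i.succ)) = 1
  closed : path 0 = path (Fin.last (2 * halfLength))

/-- Every set of rooted loops is measurable. -/
instance RootedLoop.instMeasurableSpace (d : ℕ) : MeasurableSpace (RootedLoop d) := ⊤

/-- The set of vertices visited by a loop, in Euclidean space. -/
def RootedLoop.trace {d : ℕ} (γ : RootedLoop d) : Set (EuclideanSpace ℝ (Fin d)) :=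
  Set.range (fun i => latticePoint (γ.path i))

/-- The random walk loop measure: each loop of length `2 n` has mass `(1 / 2n) (1 / 2d)^(2n)`. -/
def loopMeasure (d : ℕ) : Measure (RootedLoop d) :=
  Measure.sum (fun γ : RootedLoop d =>
    ENNReal.ofReal (1 / (2 * (γ.halfLength : ℝ)) * (1 / (2 * (d : ℝ))) ^ (2 * γ.halfLength)) •
      Measure.dirac γ)

/-- `N` is a Poisson point process on `X` with intensity measure `ν`, on the probability space
`(Ω, P)`. The random multiset of points is encoded by its counting measure `N ω`. -/
structure IsPoissonPointProcess {Ω X : Type*} [MeasurableSpace Ω] [MeasurableSpace X]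
    (N : Ω → Measure X) (ν : Measure X) (P : Measure Ω) : Prop where
  measurable : Measurable N
  /-- each `N ω` counts the points of a finite or countably infinite multiset -/
  counting : ∀ ω, ∃ (I : Set ℕ) (x : ℕ → X), N ω = Measure.sum (fun i : I => Measure.dirac (x i))
  /-- the number of points in a set of finite intensity is Poisson distributed -/
  law : ∀ A : Set X, MeasurableSet A → ν A ≠ ∞ →
    P.map (fun ω => N ω A) = (poissonMeasure (ν A).toNNReal).map (fun k : ℕ => (k : ℝ≥0∞))
  /-- a set of infinite intensity contains infinitely many points -/
  law_top : ∀ A : Set X, MeasurableSet A → ν A = ∞ → ∀ᵐ ω ∂P, N ω A = ∞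
  /-- the numbers of points in disjoint sets are independent -/
  indep : ∀ (m : ℕ) (A : Fin m → Set X), (∀ i, MeasurableSet (A i)) →
    Pairwise (fun i j => Disjoint (A i) (A j)) → iIndepFun (fun i ω => N ω (A i)) P

/-- `S` is a random walk loop soup in `ℤ^d`: a Poisson point process of pairs (loop, label) on
`RootedLoop d × (0, ∞)` whose intensity is the product of the loop measure and Lebesgue measure. -/
def IsLoopSoup {Ω : Type*} [MeasurableSpace Ω] (d : ℕ)
    (S : Ω → Measure (RootedLoop d × Set.Ioi (0 : ℝ))) (P : Measure Ω) : Prop :=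
  IsPoissonPointProcess S ((loopMeasure d).prod (Measure.comap Subtype.val volume)) P

/-- The loop soup of intensity `lam` induced by the soup `S`: keep the points with label at most
`lam` and forget the labels. -/
def loopSoupAt {Ω : Type*} {d : ℕ} (S : Ω → Measure (RootedLoop d × Set.Ioi (0 : ℝ)))
    (lam : ℝ) (ω : Ω) : Measure (RootedLoop d) :=
  ((S ω).restrict {p | (p.2 : ℝ) ≤ lam}).map Prod.fst

/-- The points of `A` at distance `> r` from the complement of `A` in the ambient set `M`. -/
def innerPart {E : Type*} [PseudoEMetricSpace E] (M A : Set E) (r : ℝ) : Set E :=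
  {x | x ∈ A ∧ ENNReal.ofReal r < Metric.infEDist x (M \ A)}

/-- `U` has smooth boundary: near each boundary point, `U` is the set where a smooth function
with non-vanishing differential is negative. -/
def HasSmoothBoundary {d : ℕ} (U : Set (EuclideanSpace ℝ (Fin d))) : Prop :=
  ∀ p ∈ frontier U, ∃ (V : Set (EuclideanSpace ℝ (Fin d))) (f : EuclideanSpace ℝ (Fin d) → ℝ),
    IsOpen V ∧ p ∈ V ∧ ContDiffOn ℝ ((⊤ : ℕ∞) : WithTop ℕ∞) f V ∧ (∀ x ∈ V, fderiv ℝ f x ≠ 0) ∧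
      U ∩ V = {x | x ∈ V ∧ f x < 0}

end

/-!
The exponent is `α = 1 / 2`, and everything is a first moment bound: the probability that a Poisson
process charges a set is at most the intensity of that set (`measure_exists_loopSoup_le`), so it
suffices to bound the loop measure of the loops in `n U` that have diameter greater than `δ n` and
visit a point within distance `ε n` of the complement of `n U`
(`exists_loopMeasure_longBoundaryLoops_le`). Distances to the complement in `ℤ³` dominate distances
to the complement in `ℝ³`, and they are at least `1`, so both versions of the statement reduce to
this bound with `ε n ≥ 1`.

Sum over the `O(n³)` possible roots and over the lengths `2 k`. By time reversal, the loop may be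
supposed to do whatever it has to do in its first `k` steps (`tsum_loops_hit_le`). The time that is
left for the return to the root is of order `k`, so the heat kernel bound
(`exists_walkProb_last_le`, proved by Fourier inversion) yields a factor `k ^ (-3/2)`. This factor
is multiplied by the smaller of the following two.

* Once the loop has reached the boundary layer, it must still stay in `n U` for another `k / 2`
  steps. A smooth bounded domain satisfies a uniform exterior ball condition
  (`exists_exterior_ball`), so that there is a quadratic barrier at every boundary point. The
  discrete Laplacian of a quadratic polynomial is exact, and an induction on the number of steps
  bounds the survival probability by a multiple of `ε (1 + n² / k)` (`exists_survProb_le`).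
* A loop of diameter greater than `δ n` moves by more than `δ n / 2` away from its root. By
  exponential moments this costs a factor of order `exp (-δ n / (4 √k))`
  (`walkProb_last_displaced_le`).

For `k ≤ n²` the geometric mean of the two is at most a multiple of `√ε (n / √k) (√k / (δ n))⁵`, and
together with the number of roots, the factor `1 / (2 k)` of the loop measure and the heat kernel
this is `√ε δ⁻⁵ / (n √k)`, whose sum over `k ≤ n²` is `O(√ε δ⁻⁵)`. For `k > n²` the first estimate
alone gives a sum `O(ε)`. The domain is fixed and bounded, so `δ` may be taken bounded; the scale
on which the boundary looks flat enters the constant only.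
-/

/-! ### Averages over lattice neighbours -/

/-- The average of `f` over the six lattice neighbours of `x`. -/
noncomputable def nbrAvg (f : (Fin 3 → ℤ) → ℝ) (x : Fin 3 → ℤ) : ℝ :=
  (1 / 6) * ∑ i : Fin 3, (f (x + Pi.single i 1) + f (x - Pi.single i 1))

open Classical in
/-- The probability that the first `m` steps of the simple random walk started at `x`, viewed as a
function on `Fin (m + 1)`, belong to `A`. It is defined by recursion on the first step. -/
noncomputable def walkProb : (m : ℕ) → (Fin 3 → ℤ) → Set (Fin (m + 1) → (Fin 3 → ℤ)) → ℝ
  | 0, x, A => if (fun _ => x) ∈ A then 1 else 0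
  | m + 1, x, A => nbrAvg (fun y => walkProb m y {p | (Fin.cons x p : Fin (m + 2) → _) ∈ A}) x

lemma nbrAvg_mono {f g : (Fin 3 → ℤ) → ℝ} {x : Fin 3 → ℤ}
    (h : ∀ i : Fin 3, f (x + Pi.single i 1) ≤ g (x + Pi.single i 1) ∧
      f (x - Pi.single i 1) ≤ g (x - Pi.single i 1)) : nbrAvg f x ≤ nbrAvg g x := by
  unfold nbrAvg
  gcongr with i _
  · exact (h i).1
  · exact (h i).2

/-- `nbrAvg_mono` for functions that are ordered everywhere. -/
lemma nbrAvg_mono' {f g : (Fin 3 → ℤ) → ℝ} (h : ∀ y, f y ≤ g y) (x : Fin 3 → ℤ) :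
    nbrAvg f x ≤ nbrAvg g x := nbrAvg_mono fun _ => ⟨h _, h _⟩

lemma nbrAvg_const (c : ℝ) (x : Fin 3 → ℤ) : nbrAvg (fun _ => c) x = c := by
  simp [nbrAvg]; ring

lemma nbrAvg_const_mul (c : ℝ) (f : (Fin 3 → ℤ) → ℝ) (x : Fin 3 → ℤ) :
    nbrAvg (fun y => c * f y) x = c * nbrAvg f x := by
  simp only [nbrAvg, Finset.mul_sum]
  exact Finset.sum_congr rfl fun _ _ => by ring

lemma walkProb_mono {m : ℕ} {x : Fin 3 → ℤ} {A B : Set (Fin (m + 1) → (Fin 3 → ℤ))}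
    (h : A ⊆ B) : walkProb m x A ≤ walkProb m x B := by
  induction m generalizing x with
  | zero =>
    simp only [walkProb]
    split_ifs with h1 h2 <;> norm_num
    exact h2 (h h1)
  | succ m ih => exact nbrAvg_mono' (fun y => ih fun p hp => h hp) x

lemma walkProb_empty (m : ℕ) (x : Fin 3 → ℤ) : walkProb m x ∅ = 0 := by
  induction m generalizing x with
  | zero => simp [walkProb]
  | succ m ih =>
    have : ∀ y, walkProb m y {p | (Fin.cons x p : Fin (m + 2) → _) ∈
        (∅ : Set (Fin (m + 2) → (Fin 3 → ℤ)))} = 0 := fun y => ih y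
    simp only [walkProb, this, nbrAvg_const]

lemma walkProb_univ (m : ℕ) (x : Fin 3 → ℤ) : walkProb m x Set.univ = 1 := by
  induction m generalizing x with
  | zero => simp [walkProb]
  | succ m ih =>
    have : ∀ y, walkProb m y {p | (Fin.cons x p : Fin (m + 2) → _) ∈
        (Set.univ : Set (Fin (m + 2) → (Fin 3 → ℤ)))} = 1 := fun y => ih y
    simp only [walkProb, this, nbrAvg_const]

lemma walkProb_nonneg (m : ℕ) (x : Fin 3 → ℤ) (A : Set (Fin (m + 1) → (Fin 3 → ℤ))) :
    0 ≤ walkProb m x A :=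
  (walkProb_empty m x).symm.le.trans (walkProb_mono (Set.empty_subset A))

lemma walkProb_le_one (m : ℕ) (x : Fin 3 → ℤ) (A : Set (Fin (m + 1) → (Fin 3 → ℤ))) :
    walkProb m x A ≤ 1 :=
  (walkProb_mono (Set.subset_univ A)).trans (walkProb_univ m x).le

/-! ### The heat kernel bound -/

/-- Lebesgue measure on the torus `(-π, π]³`. -/
noncomputable def torusMeasure : Measure (Fin 3 → ℝ) :=
  Measure.pi fun _ => volume.restrict (Set.Ioc (-Real.pi) Real.pi)

instance : IsFiniteMeasure torusMeasure := by unfold torusMeasure; infer_instance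

/-- The characteristic function of a step of the simple random walk. -/
noncomputable def stepChar (θ : Fin 3 → ℝ) : ℝ := (1 / 3) * ∑ i, Real.cos (θ i)

lemma abs_stepChar_le (θ : Fin 3 → ℝ) : |stepChar θ| ≤ 1 := by
  have := fun i => Real.abs_cos_le_one (θ i)
  unfold stepChar
  simp only [Fin.sum_univ_three]
  have h0 := abs_le.1 (this 0); have h1 := abs_le.1 (this 1); have h2 := abs_le.1 (this 2)
  rw [abs_le]; constructor <;> linarith

lemma continuous_stepChar : Continuous stepChar := by unfold stepChar; fun_prop

lemma integral_cos_torus (v : Fin 3 → ℤ) :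
    ∫ θ, Real.cos (∑ i, (v i : ℝ) * θ i) ∂torusMeasure
      = if v = 0 then (2 * Real.pi) ^ 3 else 0 := by
  have h1 : ∀ θ : Fin 3 → ℝ, Real.cos (∑ i, (v i : ℝ) * θ i)
      = (∏ i, Complex.exp ((v i : ℂ) * θ i * Complex.I)).re := by
    intro θ
    rw [← Complex.exp_sum, ← Complex.exp_ofReal_mul_I_re]
    congr 2
    push_cast
    rw [Finset.sum_mul]
  have hint : Integrable (fun θ : Fin 3 → ℝ => ∏ i, Complex.exp ((v i : ℂ) * θ i * Complex.I))
      torusMeasure := by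
    refine Integrable.of_bound (C := 1) (Continuous.aestronglyMeasurable (by fun_prop)) ?_
    refine Filter.Eventually.of_forall fun θ => ?_
    rw [norm_prod]
    refine (Finset.prod_eq_one fun i _ => ?_).le
    rw [← Complex.norm_exp_ofReal_mul_I ((v i : ℝ) * θ i)]
    push_cast; rfl
  have h2 : ∫ θ, Real.cos (∑ i, (v i : ℝ) * θ i) ∂torusMeasure
      = (∏ i, ∫ t in Set.Ioc (-Real.pi) Real.pi,
          Complex.exp ((v i : ℂ) * (t : ℝ) * Complex.I)).re := by
    simp only [h1]
    have := integral_re hint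
    simp only [RCLike.re_to_complex] at this
    rw [this]
    congr 1
    exact integral_fintype_prod_eq_prod (𝕜 := ℂ)
      (fun (i : Fin 3) (t : ℝ) => Complex.exp ((v i : ℂ) * (t : ℝ) * Complex.I))
  have h3 : ∀ j : ℤ, ∫ t in Set.Ioc (-Real.pi) Real.pi,
      Complex.exp ((j : ℂ) * (t : ℝ) * Complex.I) = if j = 0 then ((2 * Real.pi : ℝ) : ℂ) else 0 := by
    intro j
    rw [← intervalIntegral.integral_of_le (by linarith [Real.pi_pos])]
    split_ifs with hj
    · subst hj; simp; ring
    · have hc : (j : ℂ) * Complex.I ≠ 0 := by simp [hj]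
      have : ∀ t : ℝ, (j : ℂ) * (t : ℝ) * Complex.I = (j : ℂ) * Complex.I * t := fun t => by ring
      simp only [this]
      rw [integral_exp_mul_complex hc]
      have : Complex.exp ((j : ℂ) * Complex.I * (Real.pi : ℝ))
          = Complex.exp ((j : ℂ) * Complex.I * (-Real.pi : ℝ)) := by
        rw [Complex.exp_eq_exp_iff_exists_int]
        exact ⟨j, by push_cast; ring⟩
      rw [this]; simp
  rw [h2]
  simp only [h3]
  split_ifs with hv
  · subst hv
    simp only [Pi.zero_apply, if_true, Finset.prod_const, Finset.card_univ, Fintype.card_fin]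
    rw [← Complex.ofReal_pow, Complex.ofReal_re]
  · obtain ⟨i, hi⟩ := Function.ne_iff.1 hv
    rw [Finset.prod_eq_zero (Finset.mem_univ i) (by simpa using hi)]; simp

lemma integrable_stepChar_pow_mul_cos (m : ℕ) (v : Fin 3 → ℤ) :
    Integrable (fun θ : Fin 3 → ℝ => stepChar θ ^ m * Real.cos (∑ i, (v i : ℝ) * θ i))
      torusMeasure := by
  refine Integrable.of_bound (C := 1) (Continuous.aestronglyMeasurable ?_) ?_
  · exact (continuous_stepChar.pow m).mul (by fun_prop)
  · refine Filter.Eventually.of_forall fun θ => ?_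
    rw [norm_mul, norm_pow, Real.norm_eq_abs, Real.norm_eq_abs]
    exact mul_le_one₀ (pow_le_one₀ (abs_nonneg _) (abs_stepChar_le θ)) (abs_nonneg _)
      (Real.abs_cos_le_one _)

/-- Fourier inversion for the transition probabilities of the simple random walk. -/
lemma walkProb_last_eq (m : ℕ) (x y : Fin 3 → ℤ) :
    walkProb m x {p | p (Fin.last m) = y} = ((2 * Real.pi) ^ 3)⁻¹ *
      ∫ θ, stepChar θ ^ m * Real.cos (∑ i, ((x - y) i : ℝ) * θ i) ∂torusMeasure := by
  induction m generalizing x with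
  | zero =>
    have : (2 * Real.pi) ^ 3 ≠ 0 := by positivity
    have h := integral_cos_torus (x - y)
    simp only [Pi.sub_apply] at h
    simp only [walkProb, pow_zero, one_mul, Set.mem_ofPred_eq, Pi.sub_apply, h, sub_eq_zero]
    split_ifs <;> simp [this]
  | succ m ih =>
    simp only [walkProb, Set.mem_ofPred_eq, ← Fin.succ_last, Fin.cons_succ, ih]
    rw [nbrAvg_const_mul]
    congr 1
    unfold nbrAvg
    simp only [← integral_add (integrable_stepChar_pow_mul_cos m _)
      (integrable_stepChar_pow_mul_cos m _)]
    have hint : ∀ i ∈ (Finset.univ : Finset (Fin 3)), Integrable (fun θ : Fin 3 → ℝ =>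
        stepChar θ ^ m * Real.cos (∑ j, (((x + Pi.single i 1 - y : Fin 3 → ℤ) j : ℤ) : ℝ) * θ j) +
          stepChar θ ^ m * Real.cos (∑ j, (((x - Pi.single i 1 - y : Fin 3 → ℤ) j : ℤ) : ℝ) * θ j))
        torusMeasure := fun i _ => (integrable_stepChar_pow_mul_cos m _).add
      (integrable_stepChar_pow_mul_cos m _)
    rw [← integral_finsetSum _ hint, ← integral_const_mul]
    congr 1; ext θ
    have key : ∀ i : Fin 3,
        Real.cos (∑ j, (((x + Pi.single i 1 - y : Fin 3 → ℤ) j : ℤ) : ℝ) * θ j) +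
          Real.cos (∑ j, (((x - Pi.single i 1 - y : Fin 3 → ℤ) j : ℤ) : ℝ) * θ j)
        = 2 * Real.cos (∑ j, (((x - y) j : ℤ) : ℝ) * θ j) * Real.cos (θ i) := by
      intro i
      have e1 : ∑ j, (((x + Pi.single i 1 - y : Fin 3 → ℤ) j : ℤ) : ℝ) * θ j
          = ∑ j, (((x - y) j : ℤ) : ℝ) * θ j + θ i := by
        have : θ i = ∑ j, (((Pi.single i 1 : Fin 3 → ℤ) j : ℤ) : ℝ) * θ j := by
          rw [Finset.sum_eq_single i] <;> simp +contextual
        rw [this, ← Finset.sum_add_distrib]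
        refine Finset.sum_congr rfl fun j _ => ?_
        simp only [Pi.add_apply, Pi.sub_apply]; push_cast; ring
      have e2 : ∑ j, (((x - Pi.single i 1 - y : Fin 3 → ℤ) j : ℤ) : ℝ) * θ j
          = ∑ j, (((x - y) j : ℤ) : ℝ) * θ j - θ i := by
        have : θ i = ∑ j, (((Pi.single i 1 : Fin 3 → ℤ) j : ℤ) : ℝ) * θ j := by
          rw [Finset.sum_eq_single i] <;> simp +contextual
        rw [this, ← Finset.sum_sub_distrib]
        refine Finset.sum_congr rfl fun j _ => ?_
        simp only [Pi.sub_apply]; push_cast; ring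
      rw [e1, e2, Real.cos_add, Real.cos_sub]; ring
    simp only [← mul_add, key]
    rw [pow_succ]
    simp only [stepChar, Fin.sum_univ_three]
    ring

/-- A product bound, so that the integral over the torus factorizes. The right-hand side equals
`1` at all eight points of `{0, π}³`, not just at the two where `|stepChar|` does. -/
lemma abs_stepChar_pow_le (m : ℕ) (θ : Fin 3 → ℝ) :
    |stepChar θ| ^ m ≤ ∏ i, Real.exp (-(m * Real.sin (θ i) ^ 2 / 6)) := by
  have h1 : ∀ t : ℝ, |Real.cos t| ≤ 1 - Real.sin t ^ 2 / 2 := by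
    intro t
    have h := Real.sin_sq_add_cos_sq t
    have : Real.sin t ^ 2 = 1 - |Real.cos t| ^ 2 := by rw [sq_abs]; linarith
    rw [this]; nlinarith [sq_nonneg (|Real.cos t| - 1)]
  have h2 : |stepChar θ| ≤ Real.exp (-(∑ i, Real.sin (θ i) ^ 2 / 6)) := by
    have h3 : |stepChar θ| ≤ 1 - ∑ i, Real.sin (θ i) ^ 2 / 6 := by
      unfold stepChar
      simp only [Fin.sum_univ_three]
      have h0 := abs_le.1 (h1 (θ 0)); have h1' := abs_le.1 (h1 (θ 1))
      have h2 := abs_le.1 (h1 (θ 2))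
      rw [abs_le]; constructor <;> linarith
    refine h3.trans ?_
    have := Real.add_one_le_exp (-(∑ i, Real.sin (θ i) ^ 2 / 6))
    linarith
  rw [← Real.exp_sum]
  refine (pow_le_pow_left₀ (abs_nonneg _) h2 m).trans (le_of_eq ?_)
  rw [← Real.exp_nat_mul]
  congr 1
  simp only [Fin.sum_univ_three]; ring

/-- Every point of `(-π, π]` is within `π / 2` of one of the zeros `-π, 0, π` of the sine. -/
lemma exp_neg_sin_sq_le {b t : ℝ} (hb : 0 ≤ b) (ht : t ∈ Set.Ioc (-Real.pi) Real.pi) :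
    Real.exp (-(b * Real.sin t ^ 2)) ≤ Real.exp (-(4 * b / Real.pi ^ 2) * t ^ 2) +
      Real.exp (-(4 * b / Real.pi ^ 2) * (t - Real.pi) ^ 2) +
      Real.exp (-(4 * b / Real.pi ^ 2) * (t + Real.pi) ^ 2) := by
  have key : ∀ u : ℝ, |u| ≤ Real.pi / 2 → Real.sin u ^ 2 = Real.sin t ^ 2 →
      Real.exp (-(b * Real.sin t ^ 2)) ≤ Real.exp (-(4 * b / Real.pi ^ 2) * u ^ 2) := by
    intro u hu hs
    have h1 := Real.mul_abs_le_abs_sin hu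
    have h2 : (2 / Real.pi * |u|) ^ 2 ≤ Real.sin t ^ 2 := by
      rw [← hs, ← sq_abs (Real.sin u)]
      exact pow_le_pow_left₀ (by positivity) h1 2
    rw [Real.exp_le_exp]
    have h3 := mul_le_mul_of_nonneg_left h2 hb
    have h4 : b * (2 / Real.pi * |u|) ^ 2 = 4 * b / Real.pi ^ 2 * u ^ 2 := by
      rw [mul_pow, sq_abs, div_pow]; ring
    linarith
  have p1 := Real.exp_pos (-(4 * b / Real.pi ^ 2) * t ^ 2)
  have p2 := Real.exp_pos (-(4 * b / Real.pi ^ 2) * (t - Real.pi) ^ 2)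
  have p3 := Real.exp_pos (-(4 * b / Real.pi ^ 2) * (t + Real.pi) ^ 2)
  obtain ⟨h1, h2⟩ := ht
  rcases le_or_gt |t| (Real.pi / 2) with h | h
  · linarith [key t h rfl]
  · rcases lt_abs.1 h with h' | h'
    · linarith [key (t - Real.pi) (abs_le.2 ⟨by linarith, by linarith [Real.pi_pos]⟩)
        (by rw [Real.sin_sub_pi]; ring)]
    · linarith [key (t + Real.pi) (abs_le.2 ⟨by linarith [Real.pi_pos], by linarith⟩)
        (by rw [Real.sin_add_pi]; ring)]

lemma integral_exp_neg_sin_sq_le {b : ℝ} (hb : 0 < b) :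
    ∫ t in Set.Ioc (-Real.pi) Real.pi, Real.exp (-(b * Real.sin t ^ 2))
      ≤ 3 * √(Real.pi / (4 * b / Real.pi ^ 2)) := by
  set c := 4 * b / Real.pi ^ 2 with hc
  have hcpos : 0 < c := by positivity
  have g0 : Integrable fun t : ℝ => Real.exp (-c * t ^ 2) := integrable_exp_neg_mul_sq hcpos
  have g1 : Integrable fun t : ℝ => Real.exp (-c * (t - Real.pi) ^ 2) :=
    g0.comp_sub_right Real.pi
  have g2 : Integrable fun t : ℝ => Real.exp (-c * (t + Real.pi) ^ 2) :=
    g0.comp_add_right Real.pi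
  calc ∫ t in Set.Ioc (-Real.pi) Real.pi, Real.exp (-(b * Real.sin t ^ 2))
      ≤ ∫ t in Set.Ioc (-Real.pi) Real.pi, (Real.exp (-c * t ^ 2) +
        Real.exp (-c * (t - Real.pi) ^ 2) + Real.exp (-c * (t + Real.pi) ^ 2)) := by
        refine setIntegral_mono_on ?_ ((g0.add g1).add g2).integrableOn measurableSet_Ioc
          fun t ht => exp_neg_sin_sq_le hb.le ht
        refine Integrable.of_bound (C := 1) (Continuous.aestronglyMeasurable (by fun_prop)) ?_
        refine Filter.Eventually.of_forall fun t => ?_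
        rw [Real.norm_eq_abs, Real.abs_exp, Real.exp_le_one_iff]
        have : 0 ≤ b * Real.sin t ^ 2 := by positivity
        linarith
    _ ≤ ∫ t : ℝ, (Real.exp (-c * t ^ 2) +
        Real.exp (-c * (t - Real.pi) ^ 2) + Real.exp (-c * (t + Real.pi) ^ 2)) :=
        setIntegral_le_integral ((g0.add g1).add g2)
          (Filter.Eventually.of_forall fun t => by simp only [Pi.zero_apply]; positivity)
    _ = 3 * √(Real.pi / c) := by
        have g01 : Integrable fun t : ℝ => Real.exp (-c * t ^ 2) +
          Real.exp (-c * (t - Real.pi) ^ 2) := g0.add g1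
        rw [integral_add g01 g2, integral_add g0 g1,
          integral_sub_right_eq_self (fun t : ℝ => Real.exp (-c * t ^ 2)) Real.pi,
          integral_add_right_eq_self (fun t : ℝ => Real.exp (-c * t ^ 2)) Real.pi,
          integral_gaussian]
        ring

/-- The uniform heat kernel bound, of order `m ^ (-3/2)`, for the simple random walk on `ℤ³`. -/
lemma exists_walkProb_last_le : ∃ C : ℝ, 0 < C ∧ ∀ (m : ℕ) (x y : Fin 3 → ℤ),
    walkProb m x {p | p (Fin.last m) = y} ≤ C / (√(m + 1)) ^ 3 := by
  refine ⟨((2 * Real.pi) ^ 3)⁻¹ * (Real.exp (1 / 6) * (3 * √(6 * Real.pi ^ 3 / 4))) ^ 3,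
    by positivity, fun m x y => ?_⟩
  rw [walkProb_last_eq, mul_div_assoc, ← div_pow]
  refine mul_le_mul_of_nonneg_left ?_ (by positivity)
  have hJ : ∫ t in Set.Ioc (-Real.pi) Real.pi, Real.exp (-(m * Real.sin t ^ 2 / 6))
      ≤ Real.exp (1 / 6) * (3 * √(6 * Real.pi ^ 3 / 4)) / √(m + 1) := by
    have hb : (0 : ℝ) < (m + 1) / 6 := by positivity
    have h1 := integral_exp_neg_sin_sq_le hb
    have h2 : √(Real.pi / (4 * (((m : ℝ) + 1) / 6) / Real.pi ^ 2))
        = √(6 * Real.pi ^ 3 / 4) / √(m + 1) := by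
      rw [← Real.sqrt_div (by positivity)]
      congr 1; field_simp
    rw [h2] at h1
    calc ∫ t in Set.Ioc (-Real.pi) Real.pi, Real.exp (-(m * Real.sin t ^ 2 / 6))
        ≤ ∫ t in Set.Ioc (-Real.pi) Real.pi,
            Real.exp (1 / 6) * Real.exp (-((m + 1) / 6 * Real.sin t ^ 2)) := by
          refine setIntegral_mono_on (Continuous.integrableOn_Ioc (by fun_prop))
            (Continuous.integrableOn_Ioc (by fun_prop)) measurableSet_Ioc fun t _ => ?_
          rw [← Real.exp_add, Real.exp_le_exp]
          nlinarith [Real.sin_sq_le_one t]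
      _ ≤ _ := by
          rw [integral_const_mul, mul_div_assoc]
          refine mul_le_mul_of_nonneg_left (h1.trans (le_of_eq ?_)) (Real.exp_pos _).le
          ring
  calc ∫ θ, stepChar θ ^ m * Real.cos (∑ i, ((x - y) i : ℝ) * θ i) ∂torusMeasure
      ≤ ∫ θ, ∏ i, Real.exp (-(m * Real.sin (θ i) ^ 2 / 6)) ∂torusMeasure := by
        refine integral_mono (integrable_stepChar_pow_mul_cos m _) ?_ fun θ => ?_
        · refine Integrable.of_bound (C := 1) (Continuous.aestronglyMeasurable (by fun_prop)) ?_
          refine Filter.Eventually.of_forall fun θ => ?_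
          rw [norm_prod]
          refine Finset.prod_le_one (fun i _ => norm_nonneg _) fun i _ => ?_
          rw [Real.norm_eq_abs, Real.abs_exp, Real.exp_le_one_iff]
          have : (0 : ℝ) ≤ m * Real.sin (θ i) ^ 2 / 6 := by positivity
          linarith
        · refine (le_abs_self _).trans ?_
          rw [abs_mul, abs_pow]
          refine (mul_le_of_le_one_right (by positivity) (Real.abs_cos_le_one _)).trans ?_
          exact abs_stepChar_pow_le m θ
    _ = ∏ _i : Fin 3, ∫ t in Set.Ioc (-Real.pi) Real.pi,
          Real.exp (-(m * Real.sin t ^ 2 / 6)) :=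
        integral_fintype_prod_eq_prod (𝕜 := ℝ)
          (fun (_ : Fin 3) (t : ℝ) => Real.exp (-(m * Real.sin t ^ 2 / 6)))
    _ ≤ _ := by
        rw [Finset.prod_const, Finset.card_univ, Fintype.card_fin]
        exact pow_le_pow_left₀ (integral_nonneg fun t => (Real.exp_pos _).le) hJ 3

/-! ### Stopping arguments -/

/-- The probability that the walk from `x` stays in `D` for `j` steps. -/
noncomputable def survProb (D : Set (Fin 3 → ℤ)) (j : ℕ) (x : Fin 3 → ℤ) : ℝ :=
  walkProb j x {p | ∀ i, p i ∈ D}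

lemma walkProb_eq_zero_of_notMem {m : ℕ} {D : Set (Fin 3 → ℤ)} {x : Fin 3 → ℤ} (hx : x ∉ D)
    {A : Set (Fin (m + 1) → (Fin 3 → ℤ))} (hA : A ⊆ {p | p 0 ∈ D}) :
    walkProb m x A = 0 := by
  cases m with
  | zero =>
    have : (fun _ => x) ∉ A := fun h => hx (hA h)
    simp [walkProb, this]
  | succ m =>
    have : {p : Fin (m + 1) → (Fin 3 → ℤ) | (Fin.cons x p : Fin (m + 2) → _) ∈ A} = ∅ := by
      ext p
      simp only [Set.mem_ofPred_eq, Set.mem_empty_iff_false, iff_false]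
      exact fun h => hx (by simpa using hA h)
    simp only [walkProb, this, walkProb_empty, nbrAvg_const]

lemma survProb_of_notMem {D : Set (Fin 3 → ℤ)} {x : Fin 3 → ℤ} (hx : x ∉ D) (j : ℕ) :
    survProb D j x = 0 := walkProb_eq_zero_of_notMem hx fun _ hp => hp 0

lemma survProb_zero {D : Set (Fin 3 → ℤ)} {x : Fin 3 → ℤ} (hx : x ∈ D) : survProb D 0 x = 1 := by
  simp [survProb, walkProb, hx]

lemma survProb_succ {D : Set (Fin 3 → ℤ)} {x : Fin 3 → ℤ} (hx : x ∈ D) (j : ℕ) :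
    survProb D (j + 1) x = nbrAvg (survProb D j) x := by
  have : {p : Fin (j + 1) → (Fin 3 → ℤ) | (Fin.cons x p : Fin (j + 2) → _) ∈
      {p : Fin (j + 2) → (Fin 3 → ℤ) | ∀ i, p i ∈ D}} = {p | ∀ i, p i ∈ D} := by
    ext p
    simp [Fin.forall_fin_succ (n := j + 1), hx]
  unfold survProb
  simp only [walkProb, this]

/-- Markov property at time `j`: survive for `j` steps, then reach `y` in at least `b` steps. -/
lemma walkProb_stay_last_le {q : ℕ → ℝ} (hq : Antitone q) {y : Fin 3 → ℤ}
    (h : ∀ m x, walkProb m x {p | p (Fin.last m) = y} ≤ q m) (D : Set (Fin 3 → ℤ))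
    {j b m : ℕ} (hm : j + b ≤ m) (x : Fin 3 → ℤ) :
    walkProb m x {p | (∀ i, p i ∈ D) ∧ p (Fin.last m) = y} ≤ survProb D j x * q b := by
  induction j generalizing m x with
  | zero =>
    by_cases hx : x ∈ D
    · rw [survProb_zero hx, one_mul]
      exact (walkProb_mono fun p hp => hp.2).trans ((h m x).trans (hq (by omega)))
    · rw [walkProb_eq_zero_of_notMem hx fun p hp => hp.1 0, survProb_of_notMem hx, zero_mul]
  | succ j ih =>
    by_cases hx : x ∈ D
    · obtain ⟨m, rfl⟩ : ∃ m', m = m' + 1 := ⟨m - 1, by omega⟩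
      have e : {p : Fin (m + 1) → (Fin 3 → ℤ) | (Fin.cons x p : Fin (m + 2) → _) ∈
          {p : Fin (m + 2) → (Fin 3 → ℤ) | (∀ i, p i ∈ D) ∧ p (Fin.last (m + 1)) = y}}
          = {p | (∀ i, p i ∈ D) ∧ p (Fin.last m) = y} := by
        ext p
        simp [Fin.forall_fin_succ (n := m + 1), hx, ← Fin.succ_last]
      rw [survProb_succ hx, mul_comm, ← nbrAvg_const_mul]
      simp only [walkProb, e]
      refine nbrAvg_mono' (fun z => ?_) x
      rw [mul_comm]
      exact ih (by omega) z
    · rw [walkProb_eq_zero_of_notMem hx fun p hp => hp.1 0, survProb_of_notMem hx, zero_mul]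

/-- Strong Markov property at the hitting time of `L`, in the form of a bound: `f` dominates the
indicator of `L` and grows at most by the factor `r` under averaging, so `r ^ a * f x` bounds the
probability that the walk from `x` hits `L` within `a` steps. -/
lemma walkProb_hit_le {D L : Set (Fin 3 → ℤ)} {y : Fin 3 → ℤ} {f : (Fin 3 → ℤ) → ℝ} {r M : ℝ}
    {b : ℕ} (hr : 1 ≤ r) (hM : 0 ≤ M) (hf : ∀ v, 0 ≤ f v) (hfL : ∀ v ∈ L, 1 ≤ f v)
    (hfr : ∀ v, nbrAvg f v ≤ r * f v)
    (h : ∀ z ∈ L, ∀ m, b ≤ m →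
      walkProb m z {p | (∀ i, p i ∈ D) ∧ p (Fin.last m) = y} ≤ M)
    {a m : ℕ} (hm : a + b ≤ m) (x : Fin 3 → ℤ) :
    walkProb m x {p | (∀ i, p i ∈ D) ∧ p (Fin.last m) = y ∧ ∃ i : Fin (m + 1), (i : ℕ) ≤ a ∧ p i ∈ L}
      ≤ r ^ a * f x * M := by
  have hit : ∀ {a m : ℕ}, a + b ≤ m → ∀ x ∈ L, walkProb m x {p | (∀ i, p i ∈ D) ∧
      p (Fin.last m) = y ∧ ∃ i : Fin (m + 1), (i : ℕ) ≤ a ∧ p i ∈ L} ≤ r ^ a * f x * M := by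
    intro a m hm x hx
    refine le_trans (walkProb_mono fun p hp => And.intro hp.1 hp.2.1)
      ((h x hx m (by omega)).trans ?_)
    refine le_mul_of_one_le_left hM ?_
    exact one_le_mul_of_one_le_of_one_le (one_le_pow₀ hr) (hfL x hx)
  induction a generalizing m x with
  | zero =>
    by_cases hx : x ∈ L
    · exact hit hm x hx
    · have : walkProb m x {p | (∀ i, p i ∈ D) ∧ p (Fin.last m) = y ∧
          ∃ i : Fin (m + 1), (i : ℕ) ≤ 0 ∧ p i ∈ L} = 0 := by
        refine walkProb_eq_zero_of_notMem hx ?_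
        rintro p ⟨-, -, i, hi, hp⟩
        have : i = 0 := Fin.ext (by simpa using hi)
        rwa [this] at hp
      rw [this]
      have := hf x
      positivity
  | succ a ih =>
    by_cases hx : x ∈ L
    · exact hit hm x hx
    · obtain ⟨m, rfl⟩ : ∃ m', m = m' + 1 := ⟨m - 1, by omega⟩
      have e : {p : Fin (m + 1) → (Fin 3 → ℤ) | (Fin.cons x p : Fin (m + 2) → _) ∈
          {p : Fin (m + 2) → (Fin 3 → ℤ) | (∀ i, p i ∈ D) ∧ p (Fin.last (m + 1)) = y ∧
            ∃ i : Fin (m + 2), (i : ℕ) ≤ a + 1 ∧ p i ∈ L}}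
          ⊆ {p | (∀ i, p i ∈ D) ∧ p (Fin.last m) = y ∧
            ∃ i : Fin (m + 1), (i : ℕ) ≤ a ∧ p i ∈ L} := by
        intro p
        simp only [Set.mem_ofPred_eq, Fin.forall_fin_succ (n := m + 1),
          Fin.exists_fin_succ (n := m + 1), ← Fin.succ_last, Fin.cons_zero, Fin.cons_succ,
          Fin.val_succ, add_le_add_iff_right]
        rintro ⟨h1, h2, h3⟩
        exact ⟨h1.2, h2, h3.resolve_left fun h => hx h.2⟩
      calc _ ≤ nbrAvg (fun z => (r ^ a * M) * f z) x := by
            refine nbrAvg_mono' (fun z => (walkProb_mono e).trans ((ih (by omega) z).trans ?_)) x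
            exact le_of_eq (by ring)
        _ = r ^ a * M * nbrAvg f x := nbrAvg_const_mul _ _ _
        _ ≤ r ^ a * M * (r * f x) := by
            have := hfr x
            gcongr
        _ = _ := by ring

/-! ### Displacement of the walk -/

lemma nbrAvg_sum_cosh (θ : ℝ) (x v : Fin 3 → ℤ) :
    nbrAvg (fun v => ∑ i, Real.cosh (θ * (v i - x i))) v
      = (2 + Real.cosh θ) / 3 * ∑ i, Real.cosh (θ * (v i - x i)) := by
  have h : ∀ a b : ℤ, Real.cosh (θ * ((a + 1 : ℤ) - b)) + Real.cosh (θ * ((a - 1 : ℤ) - b))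
      = 2 * Real.cosh θ * Real.cosh (θ * (a - b)) := by
    intro a b
    have e1 : θ * (((a + 1 : ℤ) : ℝ) - b) = θ * (a - b) + θ := by push_cast; ring
    have e2 : θ * (((a - 1 : ℤ) : ℝ) - b) = θ * (a - b) - θ := by push_cast; ring
    rw [e1, e2, Real.cosh_add, Real.cosh_sub]; ring
  have h0 := h (v 0) (x 0)
  have h1 := h (v 1) (x 1)
  have h2 := h (v 2) (x 2)
  simp only [nbrAvg, Fin.sum_univ_three, Pi.add_apply, Pi.sub_apply, Pi.single_apply]
  simp only [Fin.isValue, if_true, Fin.reduceEq, if_false, add_zero, sub_zero]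
  linear_combination (1 / 6) * h0 + (1 / 6) * h1 + (1 / 6) * h2

lemma exists_half_lt_of_lt_dist {v x : Fin 3 → ℤ} {r : ℝ} (hr : 0 ≤ r)
    (h : r < dist (latticePoint v) (latticePoint x)) : ∃ i, r / 2 < |(v i : ℝ) - x i| := by
  by_contra! hc
  refine h.not_ge ?_
  rw [EuclideanSpace.dist_eq, Real.sqrt_le_left hr]
  simp only [latticePoint, Real.dist_eq, Fin.sum_univ_three]
  have := fun i => pow_le_pow_left₀ (abs_nonneg _) (hc i) 2
  have h0 := this 0; have h1 := this 1; have h2 := this 2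
  nlinarith [sq_nonneg r]

/-- Exponential moments (with parameter `1 / √k`) bound the displacement of a bridge of length
`2 k` in its first half. -/
lemma walkProb_last_displaced_le {q : ℕ → ℝ} (hq : Antitone q) {y : Fin 3 → ℤ}
    (h : ∀ m x, walkProb m x {p | p (Fin.last m) = y} ≤ q m) {k : ℕ} (hk : 1 ≤ k)
    (x : Fin 3 → ℤ) {r : ℝ} (hr : 0 ≤ r) :
    walkProb (2 * k) x {p | p (Fin.last (2 * k)) = y ∧ ∃ i : Fin (2 * k + 1), (i : ℕ) ≤ k ∧
      r < dist (latticePoint (p i)) (latticePoint x)} ≤ 12 * Real.exp (-(r / (2 * √k))) * q k := by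
  have hk0 : (0 : ℝ) < k := by exact_mod_cast hk
  set θ : ℝ := 1 / √k with hθ
  have hθ0 : 0 < θ := by positivity
  have hqk : 0 ≤ q k := (walkProb_nonneg _ _ _).trans (h k x)
  have hcosh : (2 + Real.cosh θ) / 3 ≤ Real.exp (1 / (2 * k)) := by
    have h1 := Real.one_le_cosh θ
    have h2 := Real.cosh_le_exp_half_sq θ
    have h3 : θ ^ 2 / 2 = 1 / (2 * k) := by
      rw [hθ, div_pow, Real.sq_sqrt hk0.le]; field_simp
    rw [h3] at h2
    linarith
  have main := walkProb_hit_le (D := Set.univ)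
    (L := {v | r < dist (latticePoint v) (latticePoint x)}) (y := y)
    (f := fun v => 2 * Real.exp (-(r / (2 * √k))) * ∑ i, Real.cosh (θ * (v i - x i)))
    (r := Real.exp (1 / (2 * k))) (M := q k) (b := k)
    (Real.one_le_exp (by positivity)) hqk
    (fun v => mul_nonneg (by positivity) (Finset.sum_nonneg fun i _ => (Real.cosh_pos _).le))
    (fun v hv => by
      obtain ⟨i, hi⟩ := exists_half_lt_of_lt_dist hr hv
      have h1 : Real.exp (r / (2 * √k)) / 2 ≤ Real.cosh (θ * (v i - x i)) := by
        rw [← Real.cosh_abs, Real.cosh_eq]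
        have h2 : r / (2 * √k) ≤ |θ * (v i - x i)| := by
          rw [abs_mul, abs_of_pos hθ0, hθ]
          calc r / (2 * √k) = 1 / √k * (r / 2) := by field_simp
            _ ≤ _ := by gcongr
        have := Real.exp_le_exp.2 h2
        have := Real.exp_pos (-|θ * (v i - x i)|)
        linarith
      have h3 : Real.cosh (θ * (v i - x i)) ≤ ∑ i, Real.cosh (θ * (v i - x i)) :=
        Finset.single_le_sum (f := fun i => Real.cosh (θ * (v i - x i)))
          (fun i _ => (Real.cosh_pos _).le) (Finset.mem_univ i)
      calc (1 : ℝ) = 2 * Real.exp (-(r / (2 * √k))) * (Real.exp (r / (2 * √k)) / 2) := by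
            rw [Real.exp_neg]; field_simp
        _ ≤ _ := by gcongr; exact h1.trans h3)
    (fun v => by
      rw [nbrAvg_const_mul, nbrAvg_sum_cosh]
      have : 0 ≤ 2 * Real.exp (-(r / (2 * √k))) * ∑ i, Real.cosh (θ * (v i - x i)) :=
        mul_nonneg (by positivity) (Finset.sum_nonneg fun i _ => (Real.cosh_pos _).le)
      calc _ = (2 + Real.cosh θ) / 3 *
            (2 * Real.exp (-(r / (2 * √k))) * ∑ i, Real.cosh (θ * (v i - x i))) := by ring
        _ ≤ _ := mul_le_mul_of_nonneg_right hcosh this)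
    (fun z _ m hm => (walkProb_mono fun p hp => hp.2).trans ((h m z).trans (hq hm)))
    (show k + k ≤ 2 * k by omega) x
  refine (walkProb_mono fun p hp => ?_).trans (main.trans ?_)
  · exact ⟨fun _ => Set.mem_univ _, hp⟩
  · have e1 : Real.exp (1 / (2 * k)) ^ k = Real.exp (1 / 2) := by
      rw [← Real.exp_nat_mul]; congr 1; field_simp
    have e2 : Real.exp (1 / 2) ≤ 2 := by
      have h1 : Real.exp (1 / 2) ^ 2 = Real.exp 1 := by rw [← Real.exp_nat_mul]; norm_num
      have h2 := Real.exp_one_lt_d9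
      nlinarith [Real.exp_pos (1 / 2)]
    rw [e1]
    simp only [sub_self, mul_zero, Real.cosh_zero, Finset.sum_const, Finset.card_univ,
      Fintype.card_fin, nsmul_eq_mul, mul_one]
    push_cast
    have : 0 ≤ Real.exp (-(r / (2 * √k))) * q k := by positivity
    nlinarith

/-! ### Exterior balls at a smooth boundary -/

/-- A bounded open set with smooth boundary satisfies a uniform exterior ball condition: the
inequality says that `U` avoids the ball of radius `1 / (2 K)` centred at `p + (1 / (2 K)) • ν`. -/
lemma exists_exterior_ball {d : ℕ} {U : Set (EuclideanSpace ℝ (Fin d))} (hU : IsOpen U)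
    (hb : Bornology.IsBounded U) (hs : HasSmoothBoundary U) :
    ∃ K : ℝ, 0 < K ∧ ∀ p ∈ frontier U, ∃ ν : EuclideanSpace ℝ (Fin d), ‖ν‖ = 1 ∧
      ∀ x ∈ U, inner ℝ ν (x - p) ≤ K * ‖x - p‖ ^ 2 := by
  have hc : IsCompact (frontier U) :=
    hb.isCompact_closure.of_isClosed_subset isClosed_frontier frontier_subset_closure
  refine hc.induction_on (p := fun s => ∃ K : ℝ, 0 < K ∧ ∀ p ∈ s,
    ∃ ν : EuclideanSpace ℝ (Fin d), ‖ν‖ = 1 ∧ ∀ x ∈ U, inner ℝ ν (x - p) ≤ K * ‖x - p‖ ^ 2)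
    ⟨1, one_pos, by simp⟩ ?_ ?_ ?_
  · rintro s t hst ⟨K, hK, h⟩
    exact ⟨K, hK, fun p hp => h p (hst hp)⟩
  · rintro s t ⟨K, hK, h⟩ ⟨K', hK', h'⟩
    refine ⟨max K K', lt_max_of_lt_left hK, fun p hp => ?_⟩
    rcases hp with hp | hp
    · obtain ⟨ν, hν, hx⟩ := h p hp
      exact ⟨ν, hν, fun x hxU => (hx x hxU).trans (by gcongr; exact le_max_left _ _)⟩
    · obtain ⟨ν, hν, hx⟩ := h' p hp
      exact ⟨ν, hν, fun x hxU => (hx x hxU).trans (by gcongr; exact le_max_right _ _)⟩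
  · intro p₀ hp₀
    obtain ⟨V, f, hV, hpV, hf, hdf, hUV⟩ := hs p₀ hp₀
    have hfat : ∀ x ∈ V, ContDiffAt ℝ 2 f x := fun x hx =>
      ((hf x hx).contDiffAt (hV.mem_nhds hx)).of_le
        (WithTop.coe_le_coe.2 (le_top : (2 : ℕ∞) ≤ ⊤))
    have hd1 : ContDiffAt ℝ 1 (fderiv ℝ f) p₀ :=
      (hfat p₀ hpV).fderiv_right (by norm_num)
    obtain ⟨M, t, ht, hM⟩ := hd1.exists_lipschitzOnWith
    set m := ‖fderiv ℝ f p₀‖ / 2 with hm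
    have hmpos : 0 < m := half_pos (norm_pos_iff.2 (hdf p₀ hpV))
    have hnear : ∀ᶠ x in nhds p₀, m < ‖fderiv ℝ f x‖ :=
      hd1.continuousAt.norm.eventually_const_lt (half_lt_self (norm_pos_iff.2 (hdf p₀ hpV)))
    obtain ⟨R, hR, hball⟩ := Metric.mem_nhds_iff.1
      (Filter.inter_mem (Filter.inter_mem (hV.mem_nhds hpV) ht) hnear)
    set r := R / 2 with hr
    have hrpos : 0 < r := half_pos hR
    refine ⟨Metric.ball p₀ r ∩ frontier U, Filter.inter_mem
      (mem_nhdsWithin_of_mem_nhds (Metric.ball_mem_nhds _ hrpos)) self_mem_nhdsWithin,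
      M / m + 1 / r, by positivity, ?_⟩
    rintro p ⟨hp, hpU⟩
    have hpR : p ∈ Metric.ball p₀ R := Metric.ball_subset_ball (by linarith) hp
    have hgm : m < ‖fderiv ℝ f p‖ := (hball hpR).2
    set g := (InnerProductSpace.toDual ℝ (EuclideanSpace ℝ (Fin d))).symm (fderiv ℝ f p) with hg
    have hgn : ‖g‖ = ‖fderiv ℝ f p‖ := LinearIsometryEquiv.norm_map _ _
    have hgi : ∀ v, inner ℝ g v = fderiv ℝ f p v := fun v =>
      InnerProductSpace.toDual_symm_apply
    have hgpos : 0 < ‖g‖ := by rw [hgn]; linarith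
    refine ⟨‖g‖⁻¹ • g, by rw [norm_smul, norm_inv, norm_norm, inv_mul_cancel₀ hgpos.ne'],
      fun x hx => ?_⟩
    rw [real_inner_smul_left, hgi]
    rcases lt_or_ge ‖x - p‖ r with hxp | hxp
    · have hfp : 0 ≤ f p := by
        by_contra! hneg
        have : p ∈ U ∩ V := by rw [hUV]; exact ⟨(hball hpR).1.1, hneg⟩
        rw [hU.frontier_eq] at hpU
        exact hpU.2 this.1
      have hxR : x ∈ Metric.ball p₀ R := by
        rw [Metric.mem_ball] at hp ⊢
        have := dist_triangle x p p₀
        rw [dist_eq_norm x p] at this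
        linarith
      have hfx : f x < 0 := by
        have : x ∈ U ∩ V := ⟨hx, (hball hxR).1.1⟩
        rw [hUV] at this
        exact this.2
      have hmv := Convex.norm_image_sub_le_of_norm_fderiv_le' (𝕜 := ℝ) (f := f)
        (φ := fderiv ℝ f p) (C := M * ‖x - p‖) (x := p) (y := x)
        (s := Metric.ball p₀ R ∩ Metric.closedBall p ‖x - p‖)
        (fun z hz => (hfat z (hball hz.1).1.1).differentiableAt (by norm_num))
        (fun z hz => by
          refine (hM.norm_sub_le (hball hz.1).1.2 (hball hpR).1.2).trans ?_
          gcongr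
          exact mem_closedBall_iff_norm.1 hz.2)
        ((convex_ball _ _).inter (convex_closedBall _ _))
        ⟨hpR, Metric.mem_closedBall_self (norm_nonneg _)⟩
        ⟨hxR, mem_closedBall_iff_norm.2 le_rfl⟩
      have h1 := (abs_le.1 (Real.norm_eq_abs _ ▸ hmv)).1
      have h2 : fderiv ℝ f p (x - p) ≤ M * ‖x - p‖ ^ 2 := by nlinarith
      calc ‖g‖⁻¹ * fderiv ℝ f p (x - p) ≤ ‖g‖⁻¹ * (M * ‖x - p‖ ^ 2) := by gcongr
        _ ≤ m⁻¹ * (M * ‖x - p‖ ^ 2) := by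
            have : ‖g‖⁻¹ ≤ m⁻¹ := inv_anti₀ hmpos (by rw [hgn]; exact hgm.le)
            gcongr
        _ = M / m * ‖x - p‖ ^ 2 := by ring
        _ ≤ _ := by
            have : 0 ≤ 1 / r * ‖x - p‖ ^ 2 := by positivity
            linarith
    · have h1 : ‖g‖⁻¹ * fderiv ℝ f p (x - p) ≤ ‖x - p‖ := by
        rw [← hgi]
        have := real_inner_le_norm g (x - p)
        calc ‖g‖⁻¹ * inner ℝ g (x - p) ≤ ‖g‖⁻¹ * (‖g‖ * ‖x - p‖) := by gcongr
          _ = ‖x - p‖ := by field_simp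
      have h2 : ‖x - p‖ ≤ 1 / r * ‖x - p‖ ^ 2 := by
        rw [div_mul_eq_mul_div, one_mul, le_div_iff₀ hrpos, sq]
        gcongr
      have h3 : 0 ≤ M / m * ‖x - p‖ ^ 2 := by positivity
      linarith

/-! ### The barrier -/

/-- A quadratic barrier at the point `p` with outer normal `ν`, evaluated at the lattice point `v`
scaled by `1 / n`. For a domain with exterior ball parameter `K` it is positive inside the domain
near `p`, and its discrete Laplacian is a negative constant. -/
noncomputable def barrier (K n : ℝ) (ν p : EuclideanSpace ℝ (Fin 3)) (v : Fin 3 → ℤ) : ℝ :=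
  -inner ℝ ν (n⁻¹ • latticePoint v - p) + 2 * K * ‖n⁻¹ • latticePoint v - p‖ ^ 2
    - 8 * K * (inner ℝ ν (n⁻¹ • latticePoint v - p)) ^ 2

lemma barrier_eq (K n : ℝ) (ν p : EuclideanSpace ℝ (Fin 3)) (v : Fin 3 → ℤ) :
    barrier K n ν p v = -(∑ i, ν i * (n⁻¹ * v i - p i)) + 2 * K * (∑ i, (n⁻¹ * v i - p i) ^ 2)
      - 8 * K * (∑ i, ν i * (n⁻¹ * v i - p i)) ^ 2 := by
  have h1 : inner ℝ ν (n⁻¹ • latticePoint v - p) = ∑ i, ν i * (n⁻¹ * v i - p i) := by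
    simp [PiLp.inner_apply, latticePoint, mul_comm]
  have h2 : ‖n⁻¹ • latticePoint v - p‖ ^ 2 = ∑ i, (n⁻¹ * v i - p i) ^ 2 := by
    rw [EuclideanSpace.real_norm_sq_eq]
    simp [latticePoint]
  rw [barrier, h1, h2]

lemma nbrAvg_barrier {K n : ℝ} {ν : EuclideanSpace ℝ (Fin 3)} (hν : ‖ν‖ = 1)
    (p : EuclideanSpace ℝ (Fin 3)) (c : ℝ) (v : Fin 3 → ℤ) :
    nbrAvg (fun v => barrier K n ν p v + c) v
      = barrier K n ν p v + c - 2 * K / 3 * (n⁻¹) ^ 2 := by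
  have h : ν 0 ^ 2 + ν 1 ^ 2 + ν 2 ^ 2 = 1 := by
    have := EuclideanSpace.real_norm_sq_eq ν
    rw [hν, Fin.sum_univ_three] at this
    linarith
  simp only [nbrAvg, barrier_eq, Fin.sum_univ_three, Pi.add_apply, Pi.sub_apply, Pi.single_apply,
    Fin.isValue, if_true, Fin.reduceEq, if_false, Int.cast_add, Int.cast_sub,
    Int.cast_one]
  linear_combination (-8 * K / 3 * (n⁻¹) ^ 2) * h

lemma norm_latticePoint_add_sub (v : Fin 3 → ℤ) (i : Fin 3) :
    ‖latticePoint (v + Pi.single i 1) - latticePoint v‖ = 1 ∧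
      ‖latticePoint (v - Pi.single i 1) - latticePoint v‖ = 1 := by
  have h1 : latticePoint (v + Pi.single i 1) - latticePoint v = EuclideanSpace.single i (1 : ℝ) := by
    ext j
    by_cases h : j = i <;> simp [latticePoint, Pi.single_apply, h]
  have h2 : latticePoint (v - Pi.single i 1) - latticePoint v
      = -EuclideanSpace.single i (1 : ℝ) := by
    ext j
    by_cases h : j = i <;> simp [latticePoint, Pi.single_apply, h]
  rw [h1, h2]; simp

/-- Inside the domain, near `p`, the barrier dominates the square of the distance to `p`. -/
lemma le_barrier {K n : ℝ} (hK : 0 < K) {ν p : EuclideanSpace ℝ (Fin 3)}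
    (hν : ‖ν‖ = 1) {v : Fin 3 → ℤ}
    (hv : inner ℝ ν (n⁻¹ • latticePoint v - p) ≤ K * ‖n⁻¹ • latticePoint v - p‖ ^ 2)
    (hr : ‖n⁻¹ • latticePoint v - p‖ ≤ 1 / (8 * K)) :
    K / 2 * ‖n⁻¹ • latticePoint v - p‖ ^ 2 ≤ barrier K n ν p v := by
  unfold barrier
  set w := ‖n⁻¹ • latticePoint v - p‖ with hw
  set s := inner ℝ ν (n⁻¹ • latticePoint v - p) with hs
  have hw0 : 0 ≤ w := norm_nonneg _
  have hsw : |s| ≤ w := by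
    have := abs_real_inner_le_norm ν (n⁻¹ • latticePoint v - p)
    rwa [hν, one_mul] at this
  have hKw : 8 * K * w ≤ 1 := by rwa [le_div_iff₀ (by positivity), mul_comm] at hr
  rcases le_or_gt s 0 with h | h
  · rw [abs_of_nonpos h] at hsw
    have : 8 * K * (-s) ≤ 1 := by nlinarith
    have : 8 * K * s ^ 2 ≤ -s := by nlinarith
    nlinarith [sq_nonneg w]
  · rw [abs_of_pos h] at hsw
    -- `s ≤ K w²` and `8 K w ≤ 1`, so `8 K s² ≤ K w² / 8`.
    have h1 : 8 * K * s ^ 2 ≤ K * w ^ 2 / 8 := by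
      have e1 : 8 * s ≤ w := by nlinarith
      have e2 : 64 * s ^ 2 ≤ w ^ 2 := by nlinarith
      nlinarith
    nlinarith [sq_nonneg w]

/-- The barrier changes by at most `4 / n` in a lattice step near `p`. -/
lemma barrier_sub_le {K n : ℝ} (hK : 0 < K) (hn : 0 < n) {ν p : EuclideanSpace ℝ (Fin 3)}
    (hν : ‖ν‖ = 1) {v y : Fin 3 → ℤ} (hvy : ‖latticePoint y - latticePoint v‖ = 1)
    (hv : ‖n⁻¹ • latticePoint v - p‖ ≤ 1 / (8 * K))
    (hy : ‖n⁻¹ • latticePoint y - p‖ ≤ 1 / (8 * K)) :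
    barrier K n ν p v - 4 / n ≤ barrier K n ν p y := by
  unfold barrier
  set a := n⁻¹ • latticePoint v - p with ha
  set b := n⁻¹ • latticePoint y - p with hb
  have hab : ‖b - a‖ = n⁻¹ := by
    have : b - a = n⁻¹ • (latticePoint y - latticePoint v) := by rw [ha, hb, smul_sub]; abel
    rw [this, norm_smul, hvy, mul_one, Real.norm_of_nonneg (by positivity)]
  have hsub : |inner ℝ ν b - inner ℝ ν a| ≤ n⁻¹ := by
    rw [← inner_sub_right, ← hab]
    have := abs_real_inner_le_norm ν (b - a)
    rwa [hν, one_mul] at this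
  have hia : |inner ℝ ν a| ≤ 1 / (8 * K) := by
    have := abs_real_inner_le_norm ν a
    rw [hν, one_mul] at this; linarith
  have hib : |inner ℝ ν b| ≤ 1 / (8 * K) := by
    have := abs_real_inner_le_norm ν b
    rw [hν, one_mul] at this; linarith
  have hnorm : ‖a‖ - ‖b‖ ≤ n⁻¹ := by
    rw [← hab, norm_sub_rev b a]; exact norm_sub_norm_le a b
  have hN : ‖a‖ ^ 2 - ‖b‖ ^ 2 ≤ n⁻¹ * (2 / (8 * K)) := by
    have e : ‖a‖ ^ 2 - ‖b‖ ^ 2 = (‖a‖ - ‖b‖) * (‖a‖ + ‖b‖) := by ring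
    rw [e]
    have h0 : 0 ≤ ‖a‖ + ‖b‖ := by positivity
    have h1 : ‖a‖ + ‖b‖ ≤ 2 / (8 * K) := by
      have : 2 / (8 * K) = 1 / (8 * K) + 1 / (8 * K) := by ring
      linarith
    calc _ ≤ n⁻¹ * (‖a‖ + ‖b‖) := by gcongr
      _ ≤ _ := by gcongr
  have hI : inner ℝ ν b ^ 2 - inner ℝ ν a ^ 2 ≤ n⁻¹ * (2 / (8 * K)) := by
    have e : inner ℝ ν b ^ 2 - inner ℝ ν a ^ 2
      = (inner ℝ ν b - inner ℝ ν a) * (inner ℝ ν b + inner ℝ ν a) := by ring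
    rw [e]
    refine (le_abs_self _).trans ?_
    rw [abs_mul]
    have h1 : |inner ℝ ν b + inner ℝ ν a| ≤ 2 / (8 * K) := by
      have : 2 / (8 * K) = 1 / (8 * K) + 1 / (8 * K) := by ring
      linarith [abs_add_le (inner ℝ ν b) (inner ℝ ν a)]
    gcongr
  have h1 := (abs_le.1 hsub).2
  have h2 := mul_le_mul_of_nonneg_left hN (by positivity : 0 ≤ 2 * K)
  have h3 := mul_le_mul_of_nonneg_left hI (by positivity : 0 ≤ 8 * K)
  have e2 : 2 * K * (n⁻¹ * (2 / (8 * K))) = n⁻¹ / 2 := by field_simp; norm_num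
  have e3 : 8 * K * (n⁻¹ * (2 / (8 * K))) = 2 * n⁻¹ := by field_simp
  have e4 : 4 / n = 4 * n⁻¹ := by ring
  have : 0 < n⁻¹ := by positivity
  rw [e2] at h2; rw [e3] at h3; rw [e4]
  linarith

/-- The lattice points of `n U`. -/
def latticeDomain (U : Set (EuclideanSpace ℝ (Fin 3))) (n : ℕ) : Set (Fin 3 → ℤ) :=
  {v | latticePoint v ∈ (n : ℝ) • U}

/-- Near the boundary point `p` the barrier dominates the survival probability. The summand `4 / n`
makes the right-hand side nonnegative also at the neighbours that lie outside `n U`, where the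
barrier itself may be negative. -/
lemma mul_survProb_le_barrier {U : Set (EuclideanSpace ℝ (Fin 3))} {K : ℝ} (hK : 0 < K)
    {ν p : EuclideanSpace ℝ (Fin 3)} (hν : ‖ν‖ = 1)
    (hp : ∀ x ∈ U, inner ℝ ν (x - p) ≤ K * ‖x - p‖ ^ 2) {n : ℕ} (hn : 16 * K ≤ n) (j : ℕ)
    {v : Fin 3 → ℤ} (hv : v ∈ latticeDomain U n)
    (hvp : ‖(n : ℝ)⁻¹ • latticePoint v - p‖ ≤ 1 / (8 * K)) :
    j * survProb (latticeDomain U n) j v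
      ≤ (512 * K * j + 3 / (2 * K) * n ^ 2) * (barrier K n ν p v + 4 / n) := by
  have hn0 : (0 : ℝ) < n := by linarith
  have hinner : ∀ {v}, v ∈ latticeDomain U n → inner ℝ ν ((n : ℝ)⁻¹ • latticePoint v - p)
      ≤ K * ‖(n : ℝ)⁻¹ • latticePoint v - p‖ ^ 2 := by
    intro v hv
    exact hp _ ((Set.mem_smul_set_iff_inv_smul_mem₀ hn0.ne' _ _).1 hv)
  induction j generalizing v with
  | zero =>
    have := le_barrier hK hν (hinner hv) hvp
    have : 0 ≤ barrier K n ν p v := le_trans (by positivity) this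
    simp only [Nat.cast_zero, zero_mul]
    positivity
  | succ j ih =>
    have hb := le_barrier hK hν (hinner hv) hvp
    have hb0 : 0 ≤ barrier K n ν p v := le_trans (by positivity) hb
    rcases le_or_gt (1 / (16 * K)) ‖(n : ℝ)⁻¹ • latticePoint v - p‖ with hfar | hnear
    · -- Far from `p` the barrier is bounded below, and probabilities are at most `1`.
      have h1 : 1 ≤ 512 * K * barrier K n ν p v := by
        have h2 : (1 / (16 * K)) ^ 2 ≤ ‖(n : ℝ)⁻¹ • latticePoint v - p‖ ^ 2 := by gcongr
        calc (1 : ℝ) = 512 * K * (K / 2 * (1 / (16 * K)) ^ 2) := by field_simp; norm_num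
          _ ≤ 512 * K * (K / 2 * ‖(n : ℝ)⁻¹ • latticePoint v - p‖ ^ 2) := by gcongr
          _ ≤ _ := by gcongr
      have h3 : ((j + 1 : ℕ) : ℝ) * survProb (latticeDomain U n) (j + 1) v ≤ (j + 1 : ℕ) * 1 := by
        gcongr
        exact walkProb_le_one _ _ _
      refine h3.trans ?_
      calc ((j + 1 : ℕ) : ℝ) * 1 ≤ (j + 1 : ℕ) * (512 * K * barrier K n ν p v) := by gcongr
        _ = (512 * K * (j + 1 : ℕ)) * barrier K n ν p v := by ring
        _ ≤ _ := by
            gcongr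
            · have : 0 ≤ 3 / (2 * K) * (n : ℝ) ^ 2 := by positivity
              linarith
            · have : 0 ≤ 4 / (n : ℝ) := by positivity
              linarith
    · -- Near `p` all neighbours are still in the range of the induction hypothesis. The loss of the
      -- barrier in one step, multiplied by `B`, pays for the additional `1 * survProb`.
      set B : ℝ := 512 * K * j + 3 / (2 * K) * n ^ 2 with hB
      have hB0 : 0 ≤ B := by positivity
      have hnb : ∀ y : Fin 3 → ℤ, ‖latticePoint y - latticePoint v‖ = 1 →
          j * survProb (latticeDomain U n) j y ≤ B * (barrier K n ν p y + 4 / n) := by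
        intro y hy
        have hyp : ‖(n : ℝ)⁻¹ • latticePoint y - p‖ ≤ 1 / (8 * K) := by
          have e : (n : ℝ)⁻¹ • latticePoint y - p = ((n : ℝ)⁻¹ • latticePoint v - p)
            + (n : ℝ)⁻¹ • (latticePoint y - latticePoint v) := by rw [smul_sub]; abel
          have e2 : ‖(n : ℝ)⁻¹ • (latticePoint y - latticePoint v)‖ = (n : ℝ)⁻¹ := by
            rw [norm_smul, hy, mul_one, Real.norm_of_nonneg (by positivity)]
          have e3 : (n : ℝ)⁻¹ ≤ 1 / (16 * K) := by
            rw [one_div]; exact inv_anti₀ (by positivity) hn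
          have e4 : 1 / (8 * K) = 1 / (16 * K) + 1 / (16 * K) := by field_simp; norm_num
          rw [e, e4]
          exact (norm_add_le _ _).trans (by rw [e2]; linarith)
        by_cases hyD : y ∈ latticeDomain U n
        · exact ih hyD hyp
        · rw [survProb_of_notMem hyD, mul_zero]
          have := barrier_sub_le hK hn0 hν hy hvp hyp
          exact mul_nonneg hB0 (by linarith)
      have h1 : j * survProb (latticeDomain U n) (j + 1) v
          ≤ B * (barrier K n ν p v + 4 / n - 2 * K / 3 * ((n : ℝ)⁻¹) ^ 2) := by
        rw [survProb_succ hv, ← nbrAvg_const_mul, ← nbrAvg_barrier hν, ← nbrAvg_const_mul]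
        exact nbrAvg_mono fun i => ⟨hnb _ (norm_latticePoint_add_sub v i).1,
          hnb _ (norm_latticePoint_add_sub v i).2⟩
      have h2 : 1 ≤ B * (2 * K / 3 * ((n : ℝ)⁻¹) ^ 2) := by
        calc (1 : ℝ) = 3 / (2 * K) * n ^ 2 * (2 * K / 3 * ((n : ℝ)⁻¹) ^ 2) := by field_simp
          _ ≤ _ := by
            gcongr
            have : 0 ≤ 512 * K * j := by positivity
            linarith
      have h3 : survProb (latticeDomain U n) (j + 1) v ≤ 1 := walkProb_le_one _ _ _
      have h4 : 0 ≤ 512 * K * (barrier K n ν p v + 4 / n) := by positivity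
      push_cast
      rw [hB] at *
      nlinarith

/-- A segment from a point of `U` to a point outside `U` meets the boundary of `U`. -/
lemma exists_mem_frontier_dist_le {E : Type*} [NormedAddCommGroup E] [NormedSpace ℝ E] {U : Set E}
    {x q : E} (hx : x ∈ U) (hq : q ∉ U) : ∃ p ∈ frontier U, dist x p ≤ dist x q := by
  obtain ⟨p, hp, hpU⟩ : ∃ p ∈ segment ℝ x q, p ∈ frontier U := by
    by_contra! hcon
    have hcover : segment ℝ x q ⊆ interior U ∪ (closure U)ᶜ := fun p hp => by
      by_contra h
      rw [Set.mem_union, not_or, Set.mem_compl_iff, not_not] at h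
      exact hcon p hp ⟨h.2, h.1⟩
    obtain ⟨p, -, hp1, hp2⟩ := (convex_segment x q).isPreconnected _ _ isOpen_interior
      isClosed_closure.isOpen_compl hcover
      ⟨x, left_mem_segment ℝ x q, (hcover (left_mem_segment ℝ x q)).resolve_right
        fun h => h (subset_closure hx)⟩
      ⟨q, right_mem_segment ℝ x q, (hcover (right_mem_segment ℝ x q)).resolve_left
        fun h => hq (interior_subset h)⟩
    exact hp2 (subset_closure (interior_subset hp1))
  refine ⟨p, hpU, ?_⟩
  have := dist_add_dist_of_mem_segment hp
  linarith [dist_nonneg (x := p) (y := q)]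

/-- From a point within distance `ε n` of the complement of `n U`, the walk stays in `n U` for `j`
steps with probability of order at most `ε (1 + n² / j)`. -/
lemma exists_survProb_le {U : Set (EuclideanSpace ℝ (Fin 3))} (hU : IsOpen U)
    (hb : Bornology.IsBounded U) (hs : HasSmoothBoundary U) :
    ∃ C : ℝ, 0 < C ∧ ∀ (n : ℕ) (ε : ℝ), 1 ≤ n → 1 ≤ ε * n → ∀ z ∈ latticeDomain U n,
      (∃ q ∉ (n : ℝ) • U, dist (latticePoint z) q ≤ ε * n) → ∀ j : ℕ, 1 ≤ j →
        survProb (latticeDomain U n) j z ≤ C * ε * (1 + n ^ 2 / j) := by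
  obtain ⟨K, hK, hext⟩ := exists_exterior_ball hU hb hs
  refine ⟨3072 * K + 9 / K + 16 * K, by positivity, ?_⟩
  rintro n ε hn hε z hz ⟨q, hq, hzq⟩ j hj
  have hn0 : (0 : ℝ) < n := by exact_mod_cast hn
  have hj0 : (0 : ℝ) < j := by exact_mod_cast hj
  have hε0 : 0 < ε := pos_of_mul_pos_left (by linarith) hn0.le
  rcases le_or_gt ε (1 / (16 * K)) with hsmall | hlarge
  · have hzU := (Set.mem_smul_set_iff_inv_smul_mem₀ hn0.ne' _ _).1 hz
    have hqU : (n : ℝ)⁻¹ • q ∉ U := fun h =>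
      hq ((Set.mem_smul_set_iff_inv_smul_mem₀ hn0.ne' _ _).2 h)
    obtain ⟨p, hp, hpd⟩ := exists_mem_frontier_dist_le hzU hqU
    obtain ⟨ν, hν, hνU⟩ := hext p hp
    have hw : ‖(n : ℝ)⁻¹ • latticePoint z - p‖ ≤ ε := by
      rw [← dist_eq_norm]
      refine hpd.trans ?_
      rw [dist_smul₀, Real.norm_of_nonneg (by positivity), inv_mul_le_iff₀ hn0, mul_comm]
      exact hzq
    have hninv : (n : ℝ)⁻¹ ≤ ε := by rw [inv_le_iff_one_le_mul₀ hn0]; exact hε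
    have hnK : 16 * K ≤ n := by
      have h1 := hninv.trans hsmall
      rw [one_div] at h1
      exact (inv_le_inv₀ hn0 (by positivity)).1 h1
    have h8 : ε * (8 * K) ≤ 1 := by
      rw [le_div_iff₀ (by positivity)] at hsmall; nlinarith
    have main := mul_survProb_le_barrier hK hν hνU hnK j hz
      (hw.trans (by rw [le_div_iff₀ (by positivity)]; exact h8))
    have hbar : barrier K n ν p z + 4 / n ≤ 6 * ε := by
      unfold barrier
      have h1 : -inner ℝ ν ((n : ℝ)⁻¹ • latticePoint z - p) ≤ ε := by
        have := abs_real_inner_le_norm ν ((n : ℝ)⁻¹ • latticePoint z - p)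
        rw [hν, one_mul] at this
        linarith [(abs_le.1 this).1]
      have h2 : 2 * K * ‖(n : ℝ)⁻¹ • latticePoint z - p‖ ^ 2 ≤ ε := by
        have : ‖(n : ℝ)⁻¹ • latticePoint z - p‖ ^ 2 ≤ ε ^ 2 := by gcongr
        nlinarith
      have h3 : 0 ≤ 8 * K * inner ℝ ν ((n : ℝ)⁻¹ • latticePoint z - p) ^ 2 := by positivity
      have h4 : 4 / (n : ℝ) = 4 * (n : ℝ)⁻¹ := by ring
      rw [h4]; linarith
    rw [← mul_le_mul_iff_right₀ hj0]
    calc j * survProb (latticeDomain U n) j z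
        ≤ (512 * K * j + 3 / (2 * K) * n ^ 2) * (6 * ε) := main.trans (by gcongr)
      _ = 3072 * K * (ε * j) + 9 / K * (ε * n ^ 2) := by ring
      _ ≤ 3072 * K * (ε * j + ε * n ^ 2) + 9 / K * (ε * j + ε * n ^ 2)
          + 16 * K * (ε * j + ε * n ^ 2) := by
          have h1 : 0 ≤ ε * j := by positivity
          have h2 : 0 ≤ ε * (n : ℝ) ^ 2 := by positivity
          have h3 : 0 ≤ 16 * K * (ε * j + ε * n ^ 2) := by positivity
          have h4 : 3072 * K * (ε * j) ≤ 3072 * K * (ε * j + ε * n ^ 2) := by gcongr; linarith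
          have h5 : 9 / K * (ε * n ^ 2) ≤ 9 / K * (ε * j + ε * n ^ 2) := by gcongr; linarith
          linarith
      _ = _ := by field_simp
  · -- For large `ε` the bound exceeds `1`.
    refine (walkProb_le_one _ _ _).trans ?_
    rw [div_lt_iff₀ (by positivity)] at hlarge
    have h1 : 0 ≤ (n : ℝ) ^ 2 / j := by positivity
    have h2 : 0 ≤ (3072 * K + 9 / K) * ε := by positivity
    calc (1 : ℝ) ≤ (3072 * K + 9 / K + 16 * K) * ε := by linarith
      _ ≤ _ := le_mul_of_one_le_right (by positivity) (by linarith)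

/-! ### From loops to random walk probabilities -/

/-- The nearest-neighbour paths of length `m` started at `x`. -/
def latticeWalks (m : ℕ) (x : Fin 3 → ℤ) : Set (Fin (m + 1) → (Fin 3 → ℤ)) :=
  {p | p 0 = x ∧ ∀ i : Fin m, dist (latticePoint (p i.castSucc)) (latticePoint (p i.succ)) = 1}

lemma eq_add_single_of_dist_eq_one {x y : Fin 3 → ℤ}
    (h : dist (latticePoint x) (latticePoint y) = 1) :
    ∃ i, y = x + Pi.single i 1 ∨ y = x - Pi.single i 1 := by
  rw [EuclideanSpace.dist_eq, Real.sqrt_eq_one] at h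
  simp only [latticePoint, Real.dist_eq, Fin.sum_univ_three, sq_abs] at h
  have hz : (y 0 - x 0) ^ 2 + (y 1 - x 1) ^ 2 + (y 2 - x 2) ^ 2 = 1 := by
    have : ((y 0 - x 0 : ℤ) : ℝ) ^ 2 + ((y 1 - x 1 : ℤ) : ℝ) ^ 2 + ((y 2 - x 2 : ℤ) : ℝ) ^ 2 = 1 := by
      push_cast; linarith
    exact_mod_cast this
  have key : ∀ a b c : ℤ, a ^ 2 + b ^ 2 + c ^ 2 = 1 →
      ((a = 1 ∨ a = -1) ∧ b = 0 ∧ c = 0) ∨ ((b = 1 ∨ b = -1) ∧ a = 0 ∧ c = 0) ∨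
        ((c = 1 ∨ c = -1) ∧ a = 0 ∧ b = 0) := by
    intro a b c h
    have ha1 : a ≤ 1 := by nlinarith [sq_nonneg b, sq_nonneg c]
    have ha2 : -1 ≤ a := by nlinarith [sq_nonneg b, sq_nonneg c]
    have hb1 : b ≤ 1 := by nlinarith [sq_nonneg a, sq_nonneg c]
    have hb2 : -1 ≤ b := by nlinarith [sq_nonneg a, sq_nonneg c]
    have hc1 : c ≤ 1 := by nlinarith [sq_nonneg b, sq_nonneg a]
    have hc2 : -1 ≤ c := by nlinarith [sq_nonneg b, sq_nonneg a]
    interval_cases a <;> interval_cases b <;> interval_cases c <;> simp_all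
  rcases key _ _ _ hz with ⟨h1 | h1, h2, h3⟩ | ⟨h1 | h1, h2, h3⟩ | ⟨h1 | h1, h2, h3⟩
  · exact ⟨0, Or.inl (by ext j; fin_cases j <;> simp <;> omega)⟩
  · exact ⟨0, Or.inr (by ext j; fin_cases j <;> simp <;> omega)⟩
  · exact ⟨1, Or.inl (by ext j; fin_cases j <;> simp <;> omega)⟩
  · exact ⟨1, Or.inr (by ext j; fin_cases j <;> simp <;> omega)⟩
  · exact ⟨2, Or.inl (by ext j; fin_cases j <;> simp <;> omega)⟩
  · exact ⟨2, Or.inr (by ext j; fin_cases j <;> simp <;> omega)⟩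

/-- The total weight of a set of paths started at `x` is at most its random walk probability. -/
lemma tsum_latticeWalks_le (m : ℕ) (x : Fin 3 → ℤ) (A : Set (Fin (m + 1) → (Fin 3 → ℤ))) :
    ∑' p, (latticeWalks m x ∩ A).indicator (fun _ => ENNReal.ofReal ((1 / 6) ^ m)) p
      ≤ ENNReal.ofReal (walkProb m x A) := by
  induction m generalizing x with
  | zero =>
    rw [tsum_eq_single (fun _ => x)]
    · by_cases h : (fun _ => x) ∈ A
      · refine (Set.indicator_le_self _ _ _).trans ?_
        simp [walkProb, h]
      · rw [Set.indicator_of_notMem fun hx => h hx.2]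
        exact zero_le
    · intro p hp
      refine Set.indicator_of_notMem (fun h => hp ?_) _
      ext i : 1
      rw [Fin.fin_one_eq_zero i]
      exact h.1.1
  | succ m ih =>
    set Ax : Set (Fin (m + 1) → (Fin 3 → ℤ)) := {q | (Fin.cons x q : Fin (m + 2) → _) ∈ A} with hAx
    set c := ENNReal.ofReal ((1 / 6) ^ m) with hc
    set g : (Fin 3 → ℤ) → (Fin (m + 1) → (Fin 3 → ℤ)) → ℝ≥0∞ := fun y =>
      (latticeWalks m y ∩ Ax).indicator (fun _ => c) with hg
    have hpt : ∀ (y : Fin 3 → ℤ) (q : Fin (m + 1) → (Fin 3 → ℤ)),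
        (latticeWalks (m + 1) x ∩ A).indicator (fun _ => ENNReal.ofReal ((1 / 6) ^ (m + 1)))
          (Fin.cons y q : Fin (m + 2) → (Fin 3 → ℤ)) ≤
        if y = x then ENNReal.ofReal (1 / 6) *
          ∑ i : Fin 3, (g (x + Pi.single i 1) q + g (x - Pi.single i 1) q) else 0 := by
      intro y q
      by_cases h : (Fin.cons y q : Fin (m + 2) → (Fin 3 → ℤ)) ∈ latticeWalks (m + 1) x ∩ A
      · have hyx : y = x := by simpa using h.1.1
        subst hyx
        rw [Set.indicator_of_mem h, if_pos rfl, pow_succ, mul_comm,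
          ENNReal.ofReal_mul (by norm_num)]
        refine mul_le_mul_right ?_ _
        have h0 : dist (latticePoint y) (latticePoint (q 0)) = 1 := by
          have := h.1.2 0
          simpa using this
        have hq : q ∈ latticeWalks m (q 0) ∩ Ax := by
          refine ⟨⟨rfl, fun i => ?_⟩, h.2⟩
          have := h.1.2 i.succ
          rwa [← Fin.succ_castSucc, Fin.cons_succ, Fin.cons_succ] at this
        have hgq : g (q 0) q = c := Set.indicator_of_mem hq _
        obtain ⟨i, hi⟩ := eq_add_single_of_dist_eq_one h0
        have hle := Finset.single_le_sum
          (f := fun i => g (y + Pi.single i 1) q + g (y - Pi.single i 1) q)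
          (fun i _ => zero_le) (Finset.mem_univ i)
        refine le_trans ?_ hle
        rcases hi with hi | hi
        · simp only [← hi, hgq]; exact le_self_add
        · simp only [← hi, hgq]; exact le_add_self
      · rw [Set.indicator_of_notMem h]; exact zero_le
    calc _ = ∑' yq : (Fin 3 → ℤ) × (Fin (m + 1) → (Fin 3 → ℤ)),
          (latticeWalks (m + 1) x ∩ A).indicator (fun _ => ENNReal.ofReal ((1 / 6) ^ (m + 1)))
            (Fin.cons yq.1 yq.2 : Fin (m + 2) → (Fin 3 → ℤ)) :=
          ((Fin.consEquiv (fun _ : Fin (m + 2) => Fin 3 → ℤ)).tsum_eq _).symm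
      _ ≤ ∑' yq : (Fin 3 → ℤ) × (Fin (m + 1) → (Fin 3 → ℤ)),
          if yq.1 = x then ENNReal.ofReal (1 / 6) *
          ∑ i : Fin 3, (g (x + Pi.single i 1) yq.2 + g (x - Pi.single i 1) yq.2) else 0 :=
          ENNReal.tsum_le_tsum fun yq => hpt yq.1 yq.2
      _ = ENNReal.ofReal (1 / 6) * ∑ i : Fin 3, (∑' q, g (x + Pi.single i 1) q
          + ∑' q, g (x - Pi.single i 1) q) := by
          rw [ENNReal.tsum_prod', tsum_eq_single x (fun y hy => by simp [hy])]
          simp only [if_true]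
          rw [ENNReal.tsum_mul_left, Summable.tsum_finsetSum fun _ _ => ENNReal.summable]
          simp only [ENNReal.tsum_add]
      _ ≤ ENNReal.ofReal (1 / 6) * ∑ i : Fin 3, (ENNReal.ofReal (walkProb m (x + Pi.single i 1) Ax)
          + ENNReal.ofReal (walkProb m (x - Pi.single i 1) Ax)) := by
          gcongr with i _
          · exact ih _ _
          · exact ih _ _
      _ = _ := by
          simp only [walkProb, nbrAvg]
          rw [ENNReal.ofReal_mul (by norm_num), ENNReal.ofReal_sum_of_nonneg
            fun i _ => add_nonneg (walkProb_nonneg _ _ _) (walkProb_nonneg _ _ _)]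
          congr 1
          exact Finset.sum_congr rfl fun i _ =>
            (ENNReal.ofReal_add (walkProb_nonneg _ _ _) (walkProb_nonneg _ _ _)).symm

/-- By time reversal, the loops that hit `L` weigh at most twice as much as those that hit it in
the first half of their lifetime. -/
lemma tsum_loops_hit_le (k : ℕ) (x : Fin 3 → ℤ) (D L : Set (Fin 3 → ℤ)) :
    ∑' p, (latticeWalks (2 * k) x ∩ {p | (∀ i, p i ∈ D) ∧ p (Fin.last (2 * k)) = x ∧
        ∃ i, p i ∈ L}).indicator (fun _ => ENNReal.ofReal ((1 / 6) ^ (2 * k))) p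
      ≤ ENNReal.ofReal (2 * walkProb (2 * k) x {p | (∀ i, p i ∈ D) ∧ p (Fin.last (2 * k)) = x ∧
        ∃ i : Fin (2 * k + 1), (i : ℕ) ≤ k ∧ p i ∈ L}) := by
  set c := ENNReal.ofReal ((1 / 6) ^ (2 * k)) with hc
  set S₁ : Set (Fin (2 * k + 1) → (Fin 3 → ℤ)) := {p | (∀ i, p i ∈ D) ∧
    p (Fin.last (2 * k)) = x ∧ ∃ i : Fin (2 * k + 1), (i : ℕ) ≤ k ∧ p i ∈ L} with hS₁
  set g : (Fin (2 * k + 1) → (Fin 3 → ℤ)) → ℝ≥0∞ :=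
    (latticeWalks (2 * k) x ∩ S₁).indicator (fun _ => c) with hg
  let e : (Fin (2 * k + 1) → (Fin 3 → ℤ)) ≃ (Fin (2 * k + 1) → (Fin 3 → ℤ)) :=
    Fin.revPerm.arrowCongr (Equiv.refl _)
  have he : ∀ p i, e p i = p i.rev := fun p i => rfl
  have hpt : ∀ p, (latticeWalks (2 * k) x ∩ {p | (∀ i, p i ∈ D) ∧ p (Fin.last (2 * k)) = x ∧
        ∃ i, p i ∈ L}).indicator (fun _ => c) p ≤ g p + g (e p) := by
    intro p
    by_cases hp : p ∈ latticeWalks (2 * k) x ∩ {p | (∀ i, p i ∈ D) ∧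
        p (Fin.last (2 * k)) = x ∧ ∃ i, p i ∈ L}
    · rw [Set.indicator_of_mem hp]
      obtain ⟨⟨hp0, hpn⟩, hD, hlast, i, hi⟩ := hp
      rcases le_or_gt (i : ℕ) k with hik | hik
      · have hmem : p ∈ latticeWalks (2 * k) x ∩ S₁ := ⟨⟨hp0, hpn⟩, hD, hlast, i, hik, hi⟩
        have : g p = c := Set.indicator_of_mem hmem _
        rw [this]; exact le_self_add
      · have hmem : e p ∈ latticeWalks (2 * k) x ∩ S₁ := by
          refine ⟨⟨?_, fun j => ?_⟩, fun j => hD _, ?_, i.rev, ?_, ?_⟩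
          · rw [he, Fin.rev_zero, hlast]
          · rw [he, he, Fin.rev_castSucc, Fin.rev_succ, dist_comm]
            exact hpn _
          · rw [he, Fin.rev_last, hp0]
          · rw [Fin.val_rev]; omega
          · rw [he, Fin.rev_rev]; exact hi
        have : g (e p) = c := Set.indicator_of_mem hmem _
        rw [this]; exact le_add_self
    · rw [Set.indicator_of_notMem hp]; exact zero_le
  calc _ ≤ ∑' p, (g p + g (e p)) := ENNReal.tsum_le_tsum hpt
    _ = ∑' p, g p + ∑' p, g p := by rw [ENNReal.tsum_add, e.tsum_eq g]
    _ ≤ ENNReal.ofReal (walkProb (2 * k) x S₁) + ENNReal.ofReal (walkProb (2 * k) x S₁) :=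
        add_le_add (tsum_latticeWalks_le _ _ _) (tsum_latticeWalks_le _ _ _)
    _ = _ := by
        rw [← ENNReal.ofReal_add (walkProb_nonneg _ _ _) (walkProb_nonneg _ _ _),
          two_mul (walkProb _ _ _)]

/-- A loop as its half length together with its path. -/
def RootedLoop.toSigma (γ : RootedLoop 3) : Σ k : ℕ, (Fin (2 * k + 1) → (Fin 3 → ℤ)) :=
  ⟨γ.halfLength, γ.path⟩

lemma RootedLoop.toSigma_injective : Function.Injective RootedLoop.toSigma := by
  rintro ⟨k, hk, p, hp, hc⟩ ⟨k', hk', p', hp', hc'⟩ heq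
  obtain ⟨h1, h2⟩ := Sigma.mk.inj_iff.1 heq
  dsimp only at h1 h2
  subst h1
  obtain rfl := eq_of_heq h2
  rfl

/-- The loop measure of a set of loops, bounded root by root and length by length. -/
lemma loopMeasure_le {B : Set (RootedLoop 3)} {X : Finset (Fin 3 → ℤ)}
    {Q : (k : ℕ) → (Fin 3 → ℤ) → Set (Fin (2 * k + 1) → (Fin 3 → ℤ))}
    (h : ∀ γ ∈ B, γ.path 0 ∈ X ∧ γ.path ∈ Q γ.halfLength (γ.path 0)) :
    loopMeasure 3 B ≤ ∑' k : ℕ, ENNReal.ofReal (1 / (2 * k)) * ∑ x ∈ X,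
      ∑' p, (latticeWalks (2 * k) x ∩ Q k x).indicator
        (fun _ => ENNReal.ofReal ((1 / 6) ^ (2 * k))) p := by
  set G : (Σ k : ℕ, (Fin (2 * k + 1) → (Fin 3 → ℤ))) → ℝ≥0∞ := fun kp =>
    ENNReal.ofReal (1 / (2 * kp.1)) * ∑ x ∈ X, (latticeWalks (2 * kp.1) x ∩ Q kp.1 x).indicator
      (fun _ => ENNReal.ofReal ((1 / 6) ^ (2 * kp.1))) kp.2 with hG
  calc loopMeasure 3 B ≤ ∑' γ : RootedLoop 3, G γ.toSigma := by
        unfold loopMeasure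
        rw [Measure.sum_apply _ (MeasurableSpace.measurableSet_top)]
        refine ENNReal.tsum_le_tsum fun γ => ?_
        rw [Measure.smul_apply, Measure.dirac_apply' _ MeasurableSpace.measurableSet_top,
          smul_eq_mul]
        by_cases hγ : γ ∈ B
        · obtain ⟨hX, hQ⟩ := h γ hγ
          have hmem : γ.path ∈ latticeWalks (2 * γ.halfLength) (γ.path 0) ∩
            Q γ.halfLength (γ.path 0) := ⟨⟨rfl, γ.step⟩, hQ⟩
          rw [Set.indicator_of_mem hγ, Pi.one_apply, mul_one, ENNReal.ofReal_mul (by positivity)]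
          refine mul_le_mul_right ?_ _
          have hle := Finset.single_le_sum (f := fun x =>
            (latticeWalks (2 * γ.halfLength) x ∩ Q γ.halfLength x).indicator
              (fun _ => ENNReal.ofReal ((1 / 6) ^ (2 * γ.halfLength))) γ.path)
            (fun _ _ => zero_le) hX
          refine le_trans (le_of_eq ?_) hle
          simp only [Set.indicator_of_mem hmem]
          norm_num
        · rw [Set.indicator_of_notMem hγ, mul_zero]; exact zero_le
    _ ≤ ∑' kp, G kp := by
        clear_value G
        exact ENNReal.tsum_comp_le_tsum_of_injective RootedLoop.toSigma_injective G
    _ = _ := by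
        rw [ENNReal.tsum_sigma']
        refine tsum_congr fun k => ?_
        simp only [hG]
        rw [ENNReal.tsum_mul_left, Summable.tsum_finsetSum fun _ _ => ENNReal.summable]

/-! ### Long loops near the boundary -/

/-- The lattice points of `n U` within distance `r` of the complement of `n U`. -/
def boundaryLayer (U : Set (EuclideanSpace ℝ (Fin 3))) (n : ℕ) (r : ℝ) : Set (Fin 3 → ℤ) :=
  {z | z ∈ latticeDomain U n ∧ ∃ q ∉ (n : ℝ) • U, dist (latticePoint z) q ≤ r}

/-- Both estimates on loops of length `2 k` rooted at `x`: the cost of surviving near the boundary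
and the cost of moving far away. -/
lemma exists_tsum_long_boundary_loops_le {U : Set (EuclideanSpace ℝ (Fin 3))} (hU : IsOpen U)
    (hb : Bornology.IsBounded U) (hs : HasSmoothBoundary U) :
    ∃ C : ℝ, 0 < C ∧ ∀ (n : ℕ) (ε r : ℝ), 1 ≤ n → 1 ≤ ε * n → 0 ≤ r → ∀ (k : ℕ), 1 ≤ k → ∀ x,
      ∑' p, (latticeWalks (2 * k) x ∩ {p | (∀ i, p i ∈ latticeDomain U n) ∧
          p (Fin.last (2 * k)) = x ∧ (∃ i, p i ∈ boundaryLayer U n (ε * n)) ∧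
          ∃ i, r < dist (latticePoint (p i)) (latticePoint x)}).indicator
            (fun _ => ENNReal.ofReal ((1 / 6) ^ (2 * k))) p
        ≤ ENNReal.ofReal (C / √k ^ 3 *
          min (ε * (1 + n ^ 2 / k)) (Real.exp (-(r / (2 * √k))))) := by
  obtain ⟨C₀, hC₀, hheat⟩ := exists_walkProb_last_le
  obtain ⟨C₁, hC₁, hsurv⟩ := exists_survProb_le hU hb hs
  have hanti : Antitone fun m : ℕ => C₀ / √((m : ℝ) + 1) ^ 3 := by
    intro a b hab
    dsimp only
    gcongr
  refine ⟨12 * C₁ * C₀ + 24 * C₀, by positivity, fun n ε r hn hε hr k hk x => ?_⟩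
  have hk0 : (0 : ℝ) < k := by exact_mod_cast hk
  have hn0 : (0 : ℝ) < n := by exact_mod_cast hn
  have hε0 : 0 < ε := pos_of_mul_pos_left (by linarith) hn0.le
  have hsk : 0 < √(k : ℝ) := Real.sqrt_pos.2 hk0
  have hlayer := tsum_loops_hit_le k x (latticeDomain U n) (boundaryLayer U n (ε * n))
  have hfar := tsum_loops_hit_le k x Set.univ {v | r < dist (latticePoint v) (latticePoint x)}
  have h1 : 2 * walkProb (2 * k) x {p | (∀ i, p i ∈ latticeDomain U n) ∧
      p (Fin.last (2 * k)) = x ∧ ∃ i : Fin (2 * k + 1), (i : ℕ) ≤ k ∧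
        p i ∈ boundaryLayer U n (ε * n)} ≤ 12 * C₁ * C₀ / √k ^ 3 * (ε * (1 + n ^ 2 / k)) := by
    -- At the hitting time at least `k` steps are left: `j` of them for the survival, and at least
    -- `k / 2` for the return to the root.
    set j := k - k / 2 with hj
    have hj1 : 1 ≤ j := by omega
    have hjk : (k : ℝ) ≤ 2 * j := by
      have : k ≤ 2 * j := by omega
      exact_mod_cast this
    have hM : C₁ * ε * (1 + n ^ 2 / j) * (C₀ / √((k / 2 : ℕ) + 1) ^ 3)
        ≤ 6 * C₁ * C₀ / √k ^ 3 * (ε * (1 + n ^ 2 / k)) := by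
      have e1 : (1 : ℝ) + n ^ 2 / j ≤ 2 * (1 + n ^ 2 / k) := by
        have : (n : ℝ) ^ 2 / j ≤ 2 * (n ^ 2 / k) := by
          rw [← mul_div_assoc, div_le_div_iff₀ (by exact_mod_cast hj1) hk0]
          nlinarith [sq_nonneg (n : ℝ)]
        linarith
      have e2 : C₀ / √((k / 2 : ℕ) + 1) ^ 3 ≤ 3 * C₀ / √k ^ 3 := by
        have e3 : (k : ℝ) ≤ 2 * ((k / 2 : ℕ) + 1) := by
          have : k ≤ 2 * (k / 2 + 1) := by omega
          exact_mod_cast this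
        have e4 : √(k : ℝ) ^ 3 ≤ 3 * √((k / 2 : ℕ) + 1) ^ 3 := by
          have e5 : √(k : ℝ) ≤ √2 * √((k / 2 : ℕ) + 1) := by
            rw [← Real.sqrt_mul (by norm_num)]
            exact Real.sqrt_le_sqrt e3
          have e6 : √2 ^ 3 ≤ (3 : ℝ) := by
            have h2 := Real.sq_sqrt (show (0 : ℝ) ≤ 2 by norm_num)
            have h3 : √2 ≤ 3 / 2 := by
              rw [Real.sqrt_le_left (by norm_num)]; norm_num
            calc √2 ^ 3 = √2 ^ 2 * √2 := by ring
              _ ≤ 3 := by rw [h2]; linarith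
          calc √(k : ℝ) ^ 3 ≤ (√2 * √((k / 2 : ℕ) + 1)) ^ 3 := by gcongr
            _ = √2 ^ 3 * √((k / 2 : ℕ) + 1) ^ 3 := by ring
            _ ≤ _ := by gcongr
        rw [div_le_div_iff₀ (by positivity) (by positivity)]
        nlinarith
      calc _ ≤ C₁ * ε * (2 * (1 + n ^ 2 / k)) * (3 * C₀ / √k ^ 3) := by gcongr
        _ = _ := by ring
    have := walkProb_hit_le (D := latticeDomain U n) (L := boundaryLayer U n (ε * n)) (y := x)
      (f := fun _ => 1) (r := 1) (b := k) (a := k) (m := 2 * k)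
      (M := C₁ * ε * (1 + n ^ 2 / j) * (C₀ / √((k / 2 : ℕ) + 1) ^ 3)) le_rfl (by positivity)
      (fun _ => zero_le_one) (fun _ _ => le_rfl) (fun v => by rw [nbrAvg_const, mul_one])
      (fun z hz m hm => by
        refine (walkProb_stay_last_le hanti (fun m z => hheat m z x) (latticeDomain U n)
          (j := j) (b := k / 2) (by omega) z).trans ?_
        gcongr
        exact hsurv n ε hn hε z hz.1 hz.2 j hj1) (by omega) x
    rw [one_pow, one_mul, one_mul] at this
    calc _ ≤ 2 * (6 * C₁ * C₀ / √k ^ 3 * (ε * (1 + n ^ 2 / k))) := by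
          gcongr; exact this.trans hM
      _ = _ := by ring
  have h2 : 2 * walkProb (2 * k) x {p | (∀ i, p i ∈ Set.univ) ∧
      p (Fin.last (2 * k)) = x ∧ ∃ i : Fin (2 * k + 1), (i : ℕ) ≤ k ∧
        p i ∈ {v | r < dist (latticePoint v) (latticePoint x)}}
      ≤ 24 * C₀ / √k ^ 3 * Real.exp (-(r / (2 * √k))) := by
    have := walkProb_last_displaced_le hanti (fun m z => hheat m z x) hk x hr
    have e : C₀ / √((k : ℝ) + 1) ^ 3 ≤ C₀ / √k ^ 3 := by gcongr; linarith
    calc _ ≤ 2 * (12 * Real.exp (-(r / (2 * √k))) * (C₀ / √((k : ℝ) + 1) ^ 3)) := by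
          gcongr
          exact (walkProb_mono fun p hp => hp.2).trans this
      _ ≤ 2 * (12 * Real.exp (-(r / (2 * √k))) * (C₀ / √k ^ 3)) := by gcongr
      _ = _ := by ring
  rw [mul_min_of_nonneg _ _ (by positivity), ENNReal.ofReal_min]
  refine le_min (le_trans (ENNReal.tsum_le_tsum fun p => ?_)
      (hlayer.trans (ENNReal.ofReal_le_ofReal (h1.trans ?_))))
    (le_trans (ENNReal.tsum_le_tsum fun p => ?_)
      (hfar.trans (ENNReal.ofReal_le_ofReal (h2.trans ?_))))
  · refine Set.indicator_le_indicator_of_subset (fun p hp => ?_) (fun _ => zero_le) p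
    exact ⟨hp.1, hp.2.1, hp.2.2.1, hp.2.2.2.1⟩
  · gcongr; linarith [mul_pos hC₁ hC₀]
  · refine Set.indicator_le_indicator_of_subset (fun p hp => ?_) (fun _ => zero_le) p
    exact ⟨hp.1, fun _ => Set.mem_univ _, hp.2.2.1, hp.2.2.2.2⟩
  · gcongr; linarith [mul_pos hC₁ hC₀]

/-! ### Summation over the lengths -/

/-- The contribution of loops of length `2 k`, up to constants. -/
noncomputable def lengthWeight (n k : ℕ) : ℝ :=
  if k ≤ n ^ 2 then 1 / (n * √k) else (n : ℝ) ^ 2 / (k : ℝ) ^ 2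

lemma lengthWeight_nonneg (n k : ℕ) : 0 ≤ lengthWeight n k := by
  unfold lengthWeight; split_ifs <;> positivity

lemma sum_lengthWeight_le {n : ℕ} (hn : 1 ≤ n) (N : ℕ) :
    ∑ k ∈ Finset.range N, lengthWeight n (k + 1) ≤ 3 := by
  have hn0 : (0 : ℝ) < n := by exact_mod_cast hn
  -- A telescoping bound; both expressions equal `2` at `N = n²`.
  have key : ∑ k ∈ Finset.range N, lengthWeight n (k + 1)
      ≤ if N ≤ n ^ 2 then 2 * √N / n else 3 - (n : ℝ) ^ 2 / N := by
    induction N with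
    | zero => simp
    | succ N ih =>
      rw [Finset.sum_range_succ]
      rcases lt_trichotomy N (n ^ 2) with h | h | h
      · rw [if_pos h.le] at ih
        rw [if_pos (show N + 1 ≤ n ^ 2 from h), lengthWeight, if_pos (show N + 1 ≤ n ^ 2 from h)]
        have hb : 0 < √((N + 1 : ℕ) : ℝ) := Real.sqrt_pos.2 (by positivity)
        have e : 1 / √((N + 1 : ℕ) : ℝ) ≤ 2 * √((N + 1 : ℕ) : ℝ) - 2 * √N := by
          rw [div_le_iff₀ hb]
          have h1 := Real.sq_sqrt (show (0 : ℝ) ≤ (N + 1 : ℕ) by positivity)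
          have h2 := Real.sq_sqrt (show (0 : ℝ) ≤ N by positivity)
          push_cast at *
          nlinarith [sq_nonneg (√((N : ℝ) + 1) - √N)]
        have e2 : 1 / (n * √((N + 1 : ℕ) : ℝ)) = 1 / √((N + 1 : ℕ) : ℝ) / n := by
          field_simp
        calc _ ≤ 2 * √N / n + 1 / √((N + 1 : ℕ) : ℝ) / n := by rw [e2]; gcongr
          _ ≤ 2 * √N / n + (2 * √((N + 1 : ℕ) : ℝ) - 2 * √N) / n := by gcongr
          _ = _ := by ring
      all_goals
        have hN0 : (0 : ℝ) < N := by
          have : 0 < N := by nlinarith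
          exact_mod_cast this
        rw [if_neg (by omega), lengthWeight, if_neg (by omega)]
        have e : (n : ℝ) ^ 2 / ((N + 1 : ℕ) : ℝ) ^ 2 ≤ n ^ 2 / N - n ^ 2 / (N + 1 : ℕ) := by
          rw [div_sub_div _ _ hN0.ne' (by positivity), div_le_div_iff₀ (by positivity)
            (by positivity)]
          push_cast
          have : 0 ≤ (n : ℝ) ^ 2 := by positivity
          nlinarith
      · rw [if_pos h.le] at ih
        have e3 : 2 * √(N : ℝ) / n = 3 - (n : ℝ) ^ 2 / N := by
          rw [h]; push_cast
          rw [Real.sqrt_sq hn0.le]; field_simp; norm_num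
        linarith
      · rw [if_neg (by omega)] at ih
        linarith
  refine key.trans ?_
  split_ifs with h
  · have h1 : √(N : ℝ) ≤ n := by
      rw [Real.sqrt_le_left hn0.le]; exact_mod_cast h
    rw [div_le_iff₀ hn0]; linarith
  · have : 0 ≤ (n : ℝ) ^ 2 / N := by positivity
    linarith

/-- The weight of the loops of length `2 k`. For `k ≤ n²` it combines the two estimates in the
minimum by their geometric mean, the exponential being bounded by a tenth power. -/
lemma exists_weight_le {C b T : ℝ} (hC : 0 < C) (hb : 0 < b) (hT : 0 < T) :
    ∃ A : ℝ, 0 < A ∧ ∀ (n k : ℕ) (ε δ : ℝ), 1 ≤ n → 1 ≤ k → 0 < ε → ε < δ → δ ≤ T →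
      1 / (2 * k) * ((b * n) ^ 3 * (C / √k ^ 3 *
        min (ε * (1 + n ^ 2 / k)) (Real.exp (-(δ * n / 2 / (2 * √k))))))
      ≤ A * (√ε / δ ^ 5) * lengthWeight n k := by
  set C₃ : ℝ := 4 ^ 10 * (Nat.factorial 10 : ℝ) with hC₃
  have hC₃0 : 0 < C₃ := by positivity
  refine ⟨b ^ 3 * C * (√(2 * C₃) + √T * T ^ 5), by positivity, ?_⟩
  intro n k ε δ hn hk hε hεδ hδT
  have hδ : 0 < δ := hε.trans hεδ
  have hk0 : (0 : ℝ) < k := by exact_mod_cast hk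
  have hn0 : (0 : ℝ) < n := by exact_mod_cast hn
  set t := √(k : ℝ) with ht
  have ht0 : 0 < t := Real.sqrt_pos.2 hk0
  have htk : (k : ℝ) = t ^ 2 := (Real.sq_sqrt hk0.le).symm
  have hsε : 0 < √ε := Real.sqrt_pos.2 hε
  have hsε2 : √ε ^ 2 = ε := Real.sq_sqrt hε.le
  unfold lengthWeight
  split_ifs with hkn
  · have htn : t ≤ n := by
      rw [ht, Real.sqrt_le_left hn0.le]; exact_mod_cast hkn
    have hA : ε * (1 + n ^ 2 / k) ≤ 2 * ε * (n / t) ^ 2 := by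
      have : 1 ≤ (n / t) ^ 2 := one_le_pow₀ ((one_le_div ht0).2 htn)
      rw [htk, ← div_pow]
      nlinarith
    have hB : Real.exp (-(δ * n / 2 / (2 * t))) ≤ C₃ * (t / (δ * n)) ^ 10 := by
      have h1 := Real.pow_div_factorial_le_exp (δ * n / 2 / (2 * t)) (by positivity) 10
      rw [Real.exp_neg]
      have h2 := inv_anti₀ (by positivity) h1
      refine h2.trans (le_of_eq ?_)
      rw [hC₃]; field_simp; norm_num
    have hX : min (ε * (1 + n ^ 2 / k)) (Real.exp (-(δ * n / 2 / (2 * t))))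
        ≤ √(2 * C₃) * √ε * (n / t) * (t / (δ * n)) ^ 5 := by
      have hmin0 : 0 ≤ min (ε * (1 + n ^ 2 / k)) (Real.exp (-(δ * n / 2 / (2 * t)))) :=
        le_min (by positivity) (by positivity)
      refine le_of_sq_le_sq ?_ (by positivity)
      calc _ = min (ε * (1 + n ^ 2 / k)) (Real.exp (-(δ * n / 2 / (2 * t)))) *
            min (ε * (1 + n ^ 2 / k)) (Real.exp (-(δ * n / 2 / (2 * t)))) := sq _
        _ ≤ (2 * ε * (n / t) ^ 2) * (C₃ * (t / (δ * n)) ^ 10) :=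
            mul_le_mul ((min_le_left _ _).trans hA) ((min_le_right _ _).trans hB) hmin0
              (by positivity)
        _ = √(2 * C₃) ^ 2 * √ε ^ 2 * (n / t) ^ 2 * ((t / (δ * n)) ^ 5) ^ 2 := by
            rw [hsε2, Real.sq_sqrt (by positivity)]; ring
        _ = _ := by ring
    calc _ ≤ 1 / (2 * k) * ((b * n) ^ 3 * (C / t ^ 3 *
          (√(2 * C₃) * √ε * (n / t) * (t / (δ * n)) ^ 5))) := by gcongr
      _ = 1 / 2 * (b ^ 3 * C * √(2 * C₃) * (√ε / δ ^ 5) * (1 / (n * t))) := by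
          rw [htk]; field_simp
      _ ≤ b ^ 3 * C * √(2 * C₃) * (√ε / δ ^ 5) * (1 / (n * t)) := by
          have : 0 ≤ b ^ 3 * C * √(2 * C₃) * (√ε / δ ^ 5) * (1 / (n * t)) := by positivity
          linarith
      _ ≤ _ := by
          gcongr
          have : 0 ≤ √T * T ^ 5 := by positivity
          linarith
  · have hkn' : (n : ℝ) ^ 2 ≤ k := by
      have : n ^ 2 ≤ k := by omega
      exact_mod_cast this
    have htn : n ≤ t := Real.le_sqrt_of_sq_le hkn'
    have hA : ε * (1 + n ^ 2 / k) ≤ 2 * ε := by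
      have : (n : ℝ) ^ 2 / k ≤ 1 := (div_le_one hk0).2 hkn'
      nlinarith
    have hεT : ε ≤ √T * T ^ 5 * (√ε / δ ^ 5) := by
      have h1 : √ε ≤ √T := Real.sqrt_le_sqrt (hεδ.le.trans hδT)
      have h2 : 1 ≤ T ^ 5 / δ ^ 5 := (one_le_div (by positivity)).2 (by gcongr)
      calc ε = √ε * √ε * 1 := by rw [mul_one, ← sq, hsε2]
        _ ≤ √T * √ε * (T ^ 5 / δ ^ 5) := by gcongr
        _ = _ := by ring
    calc _ ≤ 1 / (2 * k) * ((b * n) ^ 3 * (C / t ^ 3 * (2 * ε))) := by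
          gcongr; exact (min_le_left _ _).trans hA
      _ = b ^ 3 * C * ε * (n ^ 2 / (k : ℝ) ^ 2) * (n / t) := by
          rw [htk]; field_simp
      _ ≤ b ^ 3 * C * ε * (n ^ 2 / (k : ℝ) ^ 2) :=
          mul_le_of_le_one_right (by positivity) ((div_le_one ht0).2 htn)
      _ ≤ b ^ 3 * C * (√T * T ^ 5 * (√ε / δ ^ 5)) * (n ^ 2 / (k : ℝ) ^ 2) := by gcongr
      _ = b ^ 3 * C * (√T * T ^ 5) * (√ε / δ ^ 5) * (n ^ 2 / (k : ℝ) ^ 2) := by ring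
      _ ≤ _ := by
          gcongr
          have : 0 ≤ √(2 * C₃) := by positivity
          linarith

/-! ### The first moment bound -/

/-- The loops in `n U` of diameter greater than `δ n` that come within distance `ε n` of the
complement of `n U`. -/
def longBoundaryLoops (U : Set (EuclideanSpace ℝ (Fin 3))) (n : ℕ) (ε δ : ℝ) :
    Set (RootedLoop 3) :=
  {γ | (∀ i, γ.path i ∈ latticeDomain U n) ∧ (∃ i, γ.path i ∈ boundaryLayer U n (ε * n)) ∧
    δ * n < Metric.diam γ.trace}

lemma exists_lt_dist_of_lt_diam {γ : RootedLoop 3} {r : ℝ} (hr : 0 ≤ r)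
    (h : 2 * r < Metric.diam γ.trace) :
    ∃ i, r < dist (latticePoint (γ.path i)) (latticePoint (γ.path 0)) := by
  by_contra! hc
  refine h.not_ge (Metric.diam_le_of_forall_dist_le (by linarith) ?_)
  rintro _ ⟨i, rfl⟩ _ ⟨j, rfl⟩
  have := dist_triangle_right (latticePoint (γ.path i)) (latticePoint (γ.path j))
    (latticePoint (γ.path 0))
  linarith [hc i, hc j]

lemma norm_le_of_mem_latticeDomain {U : Set (EuclideanSpace ℝ (Fin 3))} {R : ℝ}
    (hR : ∀ x ∈ U, ‖x‖ ≤ R) {n : ℕ} {v : Fin 3 → ℤ} (hv : v ∈ latticeDomain U n) :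
    ‖latticePoint v‖ ≤ n * R := by
  obtain ⟨u, hu, huv⟩ := hv
  have huv : (n : ℝ) • u = latticePoint v := huv
  rw [← huv, norm_smul, Real.norm_of_nonneg (by positivity)]
  exact mul_le_mul_of_nonneg_left (hR u hu) (by positivity)

lemma exists_loopMeasure_longBoundaryLoops_le {U : Set (EuclideanSpace ℝ (Fin 3))}
    (hU : IsOpen U) (hb : Bornology.IsBounded U) (hs : HasSmoothBoundary U) :
    ∃ C : ℝ, 0 < C ∧ ∀ (n : ℕ) (ε δ : ℝ), 1 ≤ n → 1 ≤ ε * n → ε < δ →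
      loopMeasure 3 (longBoundaryLoops U n ε δ) ≤ ENNReal.ofReal (C * (√ε / δ ^ 5)) := by
  obtain ⟨R₀, hR₀⟩ := hb.exists_norm_le
  obtain ⟨R, hR⟩ := exists_nat_ge (max R₀ 1)
  have hR1 : (1 : ℝ) ≤ R := (le_max_right _ _).trans hR
  have hRU : ∀ x ∈ U, ‖x‖ ≤ R := fun x hx => (hR₀ x hx).trans ((le_max_left _ _).trans hR)
  obtain ⟨C, hC, hloops⟩ := exists_tsum_long_boundary_loops_le hU hb hs
  obtain ⟨A, hA, hweight⟩ := exists_weight_le hC (show (0 : ℝ) < 2 * R + 1 by positivity)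
    (show (0 : ℝ) < 2 * R by positivity)
  refine ⟨3 * A, by positivity, fun n ε δ hn hε hεδ => ?_⟩
  have hn0 : (0 : ℝ) < n := by exact_mod_cast hn
  have hε0 : 0 < ε := pos_of_mul_pos_left (by linarith) hn0.le
  have hδ0 : 0 < δ := hε0.trans hεδ
  rcases le_or_gt δ (2 * R) with hδR | hδR
  swap
  · -- No loop in `n U` has a diameter greater than `2 R n`.
    have : longBoundaryLoops U n ε δ = ∅ := by
      rw [Set.eq_empty_iff_forall_notMem]
      rintro γ ⟨hD, -, hdiam⟩
      refine hdiam.not_ge ((Metric.diam_le_of_forall_dist_le (C := 2 * R * n) (by positivity)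
        ?_).trans (by gcongr))
      rintro _ ⟨i, rfl⟩ _ ⟨j, rfl⟩
      have hi := norm_le_of_mem_latticeDomain hRU (hD i)
      have hj := norm_le_of_mem_latticeDomain hRU (hD j)
      rw [dist_eq_norm]
      have := norm_sub_le (latticePoint (γ.path i)) (latticePoint (γ.path j))
      dsimp only
      linarith
    rw [this, measure_empty]; exact zero_le
  set X : Finset (Fin 3 → ℤ) := Finset.Icc (fun _ => -(n * R : ℤ)) (fun _ => (n * R : ℤ)) with hX
  have hcard : ((X.card : ℕ) : ℝ) ≤ ((2 * R + 1) * n) ^ 3 := by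
    have hc : X.card = (2 * (n * R) + 1) ^ 3 := by
      rw [hX, Pi.card_Icc]
      simp only [Int.card_Icc, Finset.prod_const, Finset.card_univ, Fintype.card_fin]
      congr 1; omega
    rw [hc]; push_cast
    gcongr
    have : (1 : ℝ) ≤ n := by exact_mod_cast hn
    nlinarith
  have hDX : ∀ v ∈ latticeDomain U n, v ∈ X := by
    intro v hv
    have hle : ∀ i, |v i| ≤ n * R := fun i => by
      have h1 := (PiLp.norm_apply_le (latticePoint v) i).trans (norm_le_of_mem_latticeDomain hRU hv)
      rw [Real.norm_eq_abs] at h1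
      have h2 : |(v i : ℝ)| ≤ n * R := h1
      exact_mod_cast h2
    rw [hX, Finset.mem_Icc]
    exact ⟨fun i => (abs_le.1 (hle i)).1, fun i => (abs_le.1 (hle i)).2⟩
  set Q : (k : ℕ) → (Fin 3 → ℤ) → Set (Fin (2 * k + 1) → (Fin 3 → ℤ)) := fun k x =>
    {p | (∀ i, p i ∈ latticeDomain U n) ∧ p (Fin.last (2 * k)) = x ∧
      (∃ i, p i ∈ boundaryLayer U n (ε * n)) ∧
        ∃ i, δ * n / 2 < dist (latticePoint (p i)) (latticePoint x)} with hQ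
  have hterm : ∀ k : ℕ, ENNReal.ofReal (1 / (2 * k)) * ∑ x ∈ X,
      ∑' p, (latticeWalks (2 * k) x ∩ Q k x).indicator
        (fun _ => ENNReal.ofReal ((1 / 6) ^ (2 * k))) p
      ≤ ENNReal.ofReal (if k = 0 then 0 else A * (√ε / δ ^ 5) * lengthWeight n k) := by
    intro k
    rcases Nat.eq_zero_or_pos k with rfl | hk
    · simp
    rw [if_neg hk.ne']
    set M : ℝ := C / √k ^ 3 * min (ε * (1 + n ^ 2 / k)) (Real.exp (-(δ * n / 2 / (2 * √k))))
      with hM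
    have hM0 : 0 ≤ M := mul_nonneg (by positivity) (le_min (by positivity) (Real.exp_pos _).le)
    calc _ ≤ ENNReal.ofReal (1 / (2 * k)) * ∑ x ∈ X, ENNReal.ofReal M := by
          gcongr with x _
          exact hloops n ε (δ * n / 2) hn hε (by positivity) k hk x
      _ = ENNReal.ofReal (1 / (2 * k) * (X.card * M)) := by
          rw [Finset.sum_const, nsmul_eq_mul, ← ENNReal.ofReal_natCast,
            ← ENNReal.ofReal_mul (by positivity), ← ENNReal.ofReal_mul (by positivity)]
      _ ≤ ENNReal.ofReal (1 / (2 * k) * (((2 * R + 1) * n) ^ 3 * M)) := by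
          gcongr
      _ ≤ _ := ENNReal.ofReal_le_ofReal (hweight n k ε δ hn hk hε0 hεδ hδR)
  refine (loopMeasure_le (X := X) (Q := Q) ?_).trans ?_
  · rintro γ ⟨hD, hL, hdiam⟩
    refine ⟨hDX _ (hD 0), hD, γ.closed.symm, hL, exists_lt_dist_of_lt_diam (by positivity) ?_⟩
    linarith
  · refine (ENNReal.tsum_le_tsum hterm).trans (ENNReal.tsum_le_of_sum_range_le fun N => ?_)
    have hnonneg : ∀ k, 0 ≤ if k = 0 then 0 else A * (√ε / δ ^ 5) * lengthWeight n k := by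
      intro k
      have := lengthWeight_nonneg n k
      split_ifs <;> positivity
    rw [← ENNReal.ofReal_sum_of_nonneg fun k _ => hnonneg k]
    refine ENNReal.ofReal_le_ofReal ?_
    calc _ ≤ ∑ k ∈ Finset.range (N + 1),
          (if k = 0 then 0 else A * (√ε / δ ^ 5) * lengthWeight n k) :=
          Finset.sum_le_sum_of_subset_of_nonneg
            (Finset.range_subset_range.2 (Nat.le_succ N)) fun k _ _ => hnonneg k
      _ = A * (√ε / δ ^ 5) * ∑ k ∈ Finset.range N, lengthWeight n (k + 1) := by
          rw [Finset.sum_range_succ', Finset.mul_sum]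
          simp
      _ ≤ A * (√ε / δ ^ 5) * 3 := by
          gcongr
          exact sum_lengthWeight_le hn N
      _ = _ := by ring

/-! ### The loop soup -/

instance : Countable (RootedLoop 3) := RootedLoop.toSigma_injective.countable

lemma poissonMeasure_ne_zero_le (r : NNReal) : poissonMeasure r {k | k ≠ 0} ≤ r := by
  have h1 : {k : ℕ | k ≠ 0} = {0}ᶜ := by ext; simp
  rw [h1, prob_compl_eq_one_sub (measurableSet_singleton 0), poissonMeasure_singleton]
  have h2 : (1 : ℝ≥0∞) = ENNReal.ofReal 1 := by simp
  rw [h2, ← ENNReal.ofReal_sub _ (by positivity)]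
  simp only [pow_zero, mul_one, Nat.factorial_zero, Nat.cast_one, div_one]
  rw [← ENNReal.ofReal_coe_nnreal]
  refine ENNReal.ofReal_le_ofReal ?_
  linarith [Real.add_one_le_exp (-(r : ℝ))]

/-- The probability that the loop soup contains a loop of `B` is at most the mean number of such
loops. -/
lemma measure_exists_loopSoup_le {Ω : Type*} [MeasurableSpace Ω] {P : Measure Ω}
    {S : Ω → Measure (RootedLoop 3 × Set.Ioi (0 : ℝ))}
    (hS : IsLoopSoup 3 S P) {lam : ℝ} {B : Set (RootedLoop 3)}
    (hB : loopMeasure 3 B ≠ ∞) :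
    P {ω | ∃ γ ∈ B, loopSoupAt S lam ω {γ} ≠ 0} ≤ ENNReal.ofReal lam * loopMeasure 3 B := by
  set A : Set (RootedLoop 3 × Set.Ioi (0 : ℝ)) :=
    B ×ˢ {t : Set.Ioi (0 : ℝ) | (t : ℝ) ≤ lam} with hA
  have hmT : MeasurableSet {t : Set.Ioi (0 : ℝ) | (t : ℝ) ≤ lam} :=
    measurableSet_le measurable_subtype_coe measurable_const
  have hmA : MeasurableSet A := MeasurableSet.prod MeasurableSpace.measurableSet_top hmT
  have hvol : (Measure.comap Subtype.val volume : Measure (Set.Ioi (0 : ℝ)))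
      {t : Set.Ioi (0 : ℝ) | (t : ℝ) ≤ lam} = ENNReal.ofReal lam := by
    rw [(MeasurableEmbedding.subtype_coe measurableSet_Ioi).comap_apply]
    have : Subtype.val '' {t : Set.Ioi (0 : ℝ) | (t : ℝ) ≤ lam} = Set.Ioc 0 lam := by
      ext t
      simp only [Set.mem_image, Set.mem_ofPred_eq, Subtype.exists, Set.mem_Ioi, Set.mem_Ioc]
      exact ⟨by rintro ⟨a, h1, h2, rfl⟩; exact ⟨h1, h2⟩, fun h => ⟨t, h.1, h.2, rfl⟩⟩
    rw [this, Real.volume_Ioc, sub_zero]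
  have : SFinite (loopMeasure 3) := by unfold loopMeasure; infer_instance
  have hsigma : SigmaFinite (Measure.comap Subtype.val volume : Measure (Set.Ioi (0 : ℝ))) := by
    refine SigmaFinite.of_map _ measurable_subtype_coe.aemeasurable ?_
    rw [(MeasurableEmbedding.subtype_coe measurableSet_Ioi).map_comap]
    infer_instance
  have hν : ((loopMeasure 3).prod (Measure.comap Subtype.val volume)) A
      = ENNReal.ofReal lam * loopMeasure 3 B := by
    rw [hA, Measure.prod_prod, hvol, mul_comm]
  have hνtop : ((loopMeasure 3).prod (Measure.comap Subtype.val volume)) A ≠ ∞ := by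
    rw [hν]; exact ENNReal.mul_ne_top ENNReal.ofReal_ne_top hB
  have hlaw := hS.law A hmA hνtop
  have hmeas : Measurable fun ω => S ω A := (Measure.measurable_coe hmA).comp hS.measurable
  have hset : MeasurableSet {x : ℝ≥0∞ | x ≠ 0} := (measurableSet_singleton 0).compl
  calc P {ω | ∃ γ ∈ B, loopSoupAt S lam ω {γ} ≠ 0} ≤ P {ω | S ω A ≠ 0} := by
        refine measure_mono ?_
        rintro ω ⟨γ, hγ, hne⟩ h0
        refine hne ?_
        unfold loopSoupAt
        rw [Measure.map_apply measurable_fst MeasurableSpace.measurableSet_top,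
          Measure.restrict_apply (measurable_fst MeasurableSpace.measurableSet_top)]
        refine measure_mono_null ?_ h0
        rintro ⟨γ', t⟩ ⟨h1, h2⟩
        have : γ' = γ := h1
        subst this
        exact ⟨hγ, h2⟩
    _ = P.map (fun ω => S ω A) {x | x ≠ 0} := (Measure.map_apply hmeas hset).symm
    _ = poissonMeasure _ {k | k ≠ 0} := by
        rw [hlaw, Measure.map_apply (measurable_of_countable _) hset]
        congr 1
        ext k; simp
    _ ≤ _ := by
        refine (poissonMeasure_ne_zero_le _).trans ?_
        rw [ENNReal.coe_toNNReal hνtop, hν]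

/-! ### Distances to the complement -/

lemma exists_dist_le_of_infEDist_le {E : Type*} [PseudoMetricSpace E] [ProperSpace E] {A : Set E}
    (hA : IsOpen A) {x : E} {r : ℝ} (hr : 0 ≤ r)
    (h : Metric.infEDist x (Set.univ \ A) ≤ ENNReal.ofReal r) : ∃ q ∉ A, dist x q ≤ r := by
  have hne : (Set.univ \ A).Nonempty := by
    rw [Set.nonempty_iff_ne_empty]
    intro he
    rw [he, Metric.infEDist_empty] at h
    exact ENNReal.ofReal_ne_top (top_le_iff.1 h)
  have hcl : IsClosed (Set.univ \ A) := by
    rw [← Set.compl_eq_univ_sdiff]; exact hA.isClosed_compl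
  obtain ⟨q, hq, hqd⟩ := hcl.exists_infDist_eq_dist hne x
  refine ⟨q, hq.2, ?_⟩
  rw [← hqd, Metric.infDist]
  exact ENNReal.toReal_le_of_le_ofReal hr h

lemma one_le_dist_latticePoint {x y : Fin 3 → ℤ} (h : x ≠ y) :
    1 ≤ dist (latticePoint x) (latticePoint y) := by
  obtain ⟨i, hi⟩ := Function.ne_iff.1 h
  rw [dist_eq_norm]
  refine le_trans ?_ (PiLp.norm_apply_le (latticePoint x - latticePoint y) i)
  have h1 : (latticePoint x - latticePoint y) i = ((x i - y i : ℤ) : ℝ) := by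
    simp [latticePoint]
  rw [h1, Real.norm_eq_abs, ← Int.cast_abs]
  exact_mod_cast Int.one_le_abs (sub_ne_zero.2 hi)

theorem proposition5p1 :
    ∃ α : ℝ, 0 < α ∧
      ∀ U : Set (EuclideanSpace ℝ (Fin 3)),
        IsOpen U → IsConnected U → Bornology.IsBounded U → HasSmoothBoundary U →
        ∃ C : ℝ, ∀ (Ω : Type*) [MeasurableSpace Ω] (P : Measure Ω) [IsProbabilityMeasure P]
          (S : Ω → Measure (RootedLoop 3 × Set.Ioi (0 : ℝ))), IsLoopSoup 3 S P →
          ∀ lam ε δ : ℝ, 0 < lam → 0 < ε → ε < δ →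
            (∀ x ∈ Uᶜ, Bornology.IsBounded (connectedComponentIn Uᶜ x) →
              δ < Metric.diam (connectedComponentIn Uᶜ x)) →
            ∀ n : ℕ, 1 ≤ n →
              -- `U_n = nU ∩ ℤ³`, distances to the complement of `U_n` in `ℤ³`
              P.real {ω | ∃ γ : RootedLoop 3, loopSoupAt S lam ω {γ} ≠ 0 ∧
                  δ * n < Metric.diam γ.trace ∧
                  γ.trace ⊆ ((n : ℝ) • U) ∩ integerLattice 3 ∧
                  ¬ γ.trace ⊆ innerPart (integerLattice 3)
                      (((n : ℝ) • U) ∩ integerLattice 3) (ε * n)}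
                ≤ C * lam * (ε ^ α / δ ^ 5) ∧
              -- `U_n = nU`, distances to the complement of `U_n` in `ℝ³`
              (1 ≤ ε * n →
                P.real {ω | ∃ γ : RootedLoop 3, loopSoupAt S lam ω {γ} ≠ 0 ∧
                    δ * n < Metric.diam γ.trace ∧
                    γ.trace ⊆ (n : ℝ) • U ∧
                    ¬ γ.trace ⊆ innerPart Set.univ ((n : ℝ) • U) (ε * n)}
                  ≤ C * lam * (ε ^ α / δ ^ 5)) := by
  refine ⟨1 / 2, by norm_num, fun U hU _ hb hs => ?_⟩
  obtain ⟨C, hC, hmeas⟩ := exists_loopMeasure_longBoundaryLoops_le hU hb hs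
  refine ⟨C, fun Ω _ P _ S hS lam ε δ hlam hε hεδ _ n hn => ?_⟩
  have hn0 : (0 : ℝ) < n := by exact_mod_cast hn
  have hδ : 0 < δ := hε.trans hεδ
  have hUn : IsOpen ((n : ℝ) • U) := hU.smul₀ hn0.ne'
  rw [← Real.sqrt_eq_rpow]
  have hbound : 1 ≤ ε * n →
      P {ω | ∃ γ ∈ longBoundaryLoops U n ε δ, loopSoupAt S lam ω {γ} ≠ 0}
        ≤ ENNReal.ofReal (C * lam * (√ε / δ ^ 5)) := by
    intro h1
    have h2 := hmeas n ε δ hn h1 hεδ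
    refine (measure_exists_loopSoup_le hS
      (ne_top_of_le_ne_top ENNReal.ofReal_ne_top h2)).trans ?_
    calc _ ≤ ENNReal.ofReal lam * ENNReal.ofReal (C * (√ε / δ ^ 5)) := by gcongr
      _ = _ := by rw [← ENNReal.ofReal_mul hlam.le]; congr 1; ring
  have hreal : ∀ {E : Set Ω}, 1 ≤ ε * n →
      E ⊆ {ω | ∃ γ ∈ longBoundaryLoops U n ε δ, loopSoupAt S lam ω {γ} ≠ 0} →
      P.real E ≤ C * lam * (√ε / δ ^ 5) := fun h1 hE =>
    ENNReal.toReal_le_of_le_ofReal (by positivity) ((measure_mono hE).trans (hbound h1))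
  -- A lattice loop in `n U` that is not contained in the inner part meets the boundary layer.
  have hloop : ∀ {γ : RootedLoop 3} {i}, δ * n < Metric.diam γ.trace → γ.trace ⊆ (n : ℝ) • U →
      Metric.infEDist (latticePoint (γ.path i)) (Set.univ \ (n : ℝ) • U) ≤ ENNReal.ofReal (ε * n) →
      γ ∈ longBoundaryLoops U n ε δ := by
    intro γ i hdiam hsub hi
    have hD : ∀ i, γ.path i ∈ latticeDomain U n := fun i => hsub ⟨i, rfl⟩
    exact ⟨hD, ⟨i, hD i, exists_dist_le_of_infEDist_le hUn (by positivity) hi⟩, hdiam⟩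
  constructor
  · -- Distinct lattice points have distance at least `1`, so the event forces `1 ≤ ε n`.
    have hkey : ∀ γ : RootedLoop 3, δ * n < Metric.diam γ.trace →
        γ.trace ⊆ ((n : ℝ) • U) ∩ integerLattice 3 →
        ¬ γ.trace ⊆ innerPart (integerLattice 3) (((n : ℝ) • U) ∩ integerLattice 3) (ε * n) →
        1 ≤ ε * n ∧ γ ∈ longBoundaryLoops U n ε δ := by
      intro γ hdiam hsub hnot
      obtain ⟨_, ⟨i, rfl⟩, hx⟩ := Set.not_subset.1 hnot
      have hle : Metric.infEDist (latticePoint (γ.path i))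
          (integerLattice 3 \ (((n : ℝ) • U) ∩ integerLattice 3)) ≤ ENNReal.ofReal (ε * n) := by
        by_contra! hlt
        exact hx ⟨hsub ⟨i, rfl⟩, hlt⟩
      constructor
      · have h1 : 1 ≤ Metric.infEDist (latticePoint (γ.path i))
            (integerLattice 3 \ (((n : ℝ) • U) ∩ integerLattice 3)) := by
          refine Metric.le_infEDist.2 ?_
          rintro _ ⟨⟨y, rfl⟩, hy⟩
          have hne : γ.path i ≠ y := by
            rintro rfl
            exact hy (hsub ⟨i, rfl⟩)
          rw [edist_dist, ← ENNReal.ofReal_one]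
          exact ENNReal.ofReal_le_ofReal (one_le_dist_latticePoint hne)
        exact ENNReal.one_le_ofReal.1 (h1.trans hle)
      · refine hloop hdiam (fun x hx => (hsub hx).1) (i := i) (le_trans ?_ hle)
        exact Metric.infEDist_anti fun y hy => ⟨Set.mem_univ y, fun h => hy.2 ⟨h, hy.1⟩⟩
    by_cases h1 : 1 ≤ ε * n
    · refine hreal h1 ?_
      rintro ω ⟨γ, hne, hdiam, hsub, hnot⟩
      exact ⟨γ, (hkey γ hdiam hsub hnot).2, hne⟩
    · have : {ω | ∃ γ : RootedLoop 3, loopSoupAt S lam ω {γ} ≠ 0 ∧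
          δ * n < Metric.diam γ.trace ∧ γ.trace ⊆ ((n : ℝ) • U) ∩ integerLattice 3 ∧
          ¬ γ.trace ⊆ innerPart (integerLattice 3)
            (((n : ℝ) • U) ∩ integerLattice 3) (ε * n)} = ∅ := by
        rw [Set.eq_empty_iff_forall_notMem]
        rintro ω ⟨γ, -, hdiam, hsub, hnot⟩
        exact h1 (hkey γ hdiam hsub hnot).1
      rw [this, measureReal_empty]
      positivity
  · intro h1
    refine hreal h1 ?_
    rintro ω ⟨γ, hne, hdiam, hsub, hnot⟩
    obtain ⟨_, ⟨i, rfl⟩, hx⟩ := Set.not_subset.1 hnot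
    refine ⟨γ, hloop hdiam hsub (i := i) ?_, hne⟩
    by_contra! hlt
    exact hx ⟨hsub ⟨i, rfl⟩, hlt⟩
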